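/- Let $n_1,n_2>1$ be integers, $n=n_1+n_2$, let $a_1,\dots,a_n\in(-1,1)$, $\vec a_1=(a_1,\dots,a_{n_1})'$, $\vec a_2=(a_{n_1+1},\dots,a_n)'$, let $\alpha>0$ and let $\vartheta$ be real with $|\vartheta|\le 1$. Put $$R_\vartheta=\mathrm{Diag}(1-a_1^2,\dots,1-a_n^2)+\begin{pmatrix}\vec a_1\vec a_1' & \vartheta\,\vec a_1\vec a_2'\\ \vartheta\,\vec a_2\vec a_1' & \vec a_2\vec a_2'\end{pmatrix}.$$ The $\Gamma_n(\alpha,R)$-distribution is the probability measure on $[0,\infty)^n$ with Laplace transform $|I_n+RT|^{-\alpha}$ for all $T=\mathrm{Diag}(t_1,\dots,t_n)$, $t_i\ge 0$. For $\alpha>0$ let $g_\alpha(x)=x^{\alpha-1}e^{-x}/\Gamma(\alpha)$ $(x>0)$ be the standard gamma density, $G_\alpha(x)$ its cdf, and $$G_\alpha(x;y)=e^{-y}\sum_{m=0}^\infty G_{\alpha+m}(x)\frac{y^m}{m!}$$ the non-central gamma cdf. Let ${}_0F_1(\alpha;z)=\sum_{k\ge0}\frac{z^k}{\alpha(\alpha+1)\cdots(\alpha+k-1)\,k!}$,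 let $$L_k^{(\beta)}(y)=\sum_{m=0}^k(-1)^m\binom{k+\beta}{k-m}\frac{y^m}{m!}$$ be the generalized Laguerre polynomials, and for $x_1,\dots,x_n\in\mathbb R$ put $$G_{(1)}(\vec x_1;y)=\prod_{j\le n_1}G_\alpha\Big(\frac{x_j}{1-a_j^2};\frac{a_j^2y}{1-a_j^2}\Big),\qquad G_{(2)}(\vec x_2;y)=\prod_{n_1<j\le n}G_\alpha\Big(\frac{x_j}{1-a_j^2};\frac{a_j^2y}{1-a_j^2}\Big).$$ Then the $\Gamma_n(\alpha,R_\vartheta)$-distribution exists and is unique, and its cdf $F(x_1,\dots,x_n;\alpha,R_\vartheta)$ is given for all $x_1,\dots,x_n$ by the (absolutely convergent) series $$F(x_1,\dots,x_n;\alpha,R_\vartheta)=\sum_{k=0}^\infty\binom{\alpha+k-1}{k}^{-1}\vartheta^{2k}\int_0^\infty G_{(1)}(\vec x_1;y)L_k^{(\alpha-1)}(y)g_\alpha(y)\,dy\int_0^\infty G_{(2)}(\vec x_2;y)L_k^{(\alpha-1)}(y)g_\alpha(y)\,dy .$$ If moreover $|\vartheta|<1$, then also $$F(x_1,\dots,x_n;\alpha,R_\vartheta)=(1-\vartheta^2)^\alpha\int_{(0,\infty)^2}G_{(1)}(\vec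 x_1;(1-\vartheta^2)y_1)\,G_{(2)}(\vec x_2;(1-\vartheta^2)y_2)\,{}_0F_1(\alpha;\vartheta^2y_1y_2)\,g_\alpha(y_1)g_\alpha(y_2)\,dy_1dy_2 .$$ All integrals converge absolutely. -/

import Mathlib

open MeasureTheory ProbabilityTheory Set

namespace MultivariateGamma

/-- The density `g_α(x) = x ^ (α - 1) * exp (-x) / Γ(α)`, `x > 0`, of the univariate standard
gamma distribution. -/
noncomputable def gPdf (α x : ℝ) : ℝ := gammaPDFReal α 1 x

/-- The cdf `G_α(x)` of the univariate standard gamma distribution. -/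
noncomputable def gCdf (α x : ℝ) : ℝ := cdf (gammaMeasure α 1) x

/-- The non-central gamma cdf
`G_α(x; y) = exp (-y) * ∑ₙ G_{α + n}(x) * y ^ n / n!`
with non-centrality parameter `y`. -/
noncomputable def ncCdf (α x y : ℝ) : ℝ :=
  Real.exp (-y) * ∑' n : ℕ, gCdf (α + n) x * (y ^ n / (n.factorial : ℝ))

/-- The hypergeometric function `₀F₁(α; z) = ∑ₖ z ^ k / ((α)ₖ * k!)`, with the rising factorial
`(α)ₖ = α (α + 1) ⋯ (α + k - 1)`. -/
noncomputable def hyp0F1 (α z : ℝ) : ℝ :=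
  ∑' k : ℕ, z ^ k / ((ascPochhammer ℝ k).eval α * (k.factorial : ℝ))

/-- The generalized Laguerre polynomial
`L_k^(β)(y) = ∑_{m ≤ k} (-1) ^ m * binom(k + β, k - m) * y ^ m / m!`. -/
noncomputable def laguerre (β : ℝ) (k : ℕ) (y : ℝ) : ℝ :=
  ∑ m ∈ Finset.range (k + 1),
    (-1) ^ m * Ring.choose ((k : ℝ) + β) (k - m) * (y ^ m / (m.factorial : ℝ))

/-- `μ` is the `Γ_n(α, R)`-distribution: the probability measure on the non-negative orthant
with Laplace transform `det (I + R T) ^ (-α)`, `T = Diag(t₁, …, tₙ)`, `tᵢ ≥ 0`. -/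
structure IsGammaLaw {ι : Type*} [Fintype ι] [DecidableEq ι] (α : ℝ) (R : Matrix ι ι ℝ)
    (μ : Measure (ι → ℝ)) : Prop where
  isProbabilityMeasure : IsProbabilityMeasure μ
  nonneg : ∀ᵐ x ∂μ, ∀ i, 0 ≤ x i
  laplace : ∀ t : ι → ℝ, (∀ i, 0 ≤ t i) →
    ∫ x, Real.exp (-∑ i, t i * x i) ∂μ = (1 + R * Matrix.diagonal t).det ^ (-α)

/-- The joint cdf `F(x₁, …, xₙ) = μ {z | z₁ ≤ x₁, …, zₙ ≤ xₙ}`. -/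
noncomputable def jointCdf {ι : Type*} (μ : Measure (ι → ℝ)) (x : ι → ℝ) : ℝ :=
  μ.real {z | ∀ i, z i ≤ x i}

/-- The two-block correlation matrix
`[D₁ + a₁ a₁ᵀ, ϑ a₁ a₂ᵀ; ϑ a₂ a₁ᵀ, D₂ + a₂ a₂ᵀ]` with `Dᵢ = Diag(…, 1 - a² , …)`. -/
noncomputable def twoBlockCorr {n₁ n₂ : ℕ} (a₁ : Fin n₁ → ℝ) (a₂ : Fin n₂ → ℝ) (ϑ : ℝ) :
    Matrix (Fin n₁ ⊕ Fin n₂) (Fin n₁ ⊕ Fin n₂) ℝ :=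
  Matrix.fromBlocks
    (Matrix.diagonal (fun j => 1 - a₁ j ^ 2) + Matrix.vecMulVec a₁ a₁)
    (ϑ • Matrix.vecMulVec a₁ a₂)
    (ϑ • Matrix.vecMulVec a₂ a₁)
    (Matrix.diagonal (fun j => 1 - a₂ j ^ 2) + Matrix.vecMulVec a₂ a₂)

/-- The product of non-central gamma cdfs
`∏ⱼ G_α((1 - aⱼ²)⁻¹ xⱼ; (1 - aⱼ²)⁻¹ aⱼ² y)` over one block. -/
noncomputable def blockProd {m : ℕ} (α : ℝ) (a x : Fin m → ℝ) (y : ℝ) : ℝ :=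
  ∏ j, ncCdf α ((1 - a j ^ 2)⁻¹ * x j) ((1 - a j ^ 2)⁻¹ * a j ^ 2 * y)

end MultivariateGamma

/-!
Let `(y₁, y₂)` follow Kibble's bivariate gamma distribution, whose Laplace transform is
`((1 + s)(1 + t) - ϑ² s t)^(-α)`. If, given `(y₁, y₂)`, the components of a vector are independent
non-central gamma variables with non-centralities proportional to `y₁` in the first block and to
`y₂` in the second, then the vector has Laplace transform `|I + R_ϑ T|^(-α)`: the matrix `I + R_ϑ T`
is a rank-two perturbation of a diagonal matrix, so its determinant reduces to a `2 × 2` one. Hence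
the cdf is the expectation of `G₍₁₎(y₁) G₍₂₎(y₂)`.

For `ϑ² < 1`, Kibble's distribution has a density with a `₀F₁` factor, which gives the double
integral; for `ϑ² = 1` it sits on the diagonal. For the series, both `(f, g) ↦ 𝔼 f(y₁) g(y₂)` and
the diagonal Laguerre form with eigenvalues `ϑ^(2k)` are continuous bilinear forms on `L²` of the
gamma distribution. On exponentials they agree by the binomial series for `(1 - z)^(-α)`, and
exponentials span a dense subspace by uniqueness of the Laplace transform.
-/

namespace MultivariateGamma

section Pochhammer

lemma Gamma_add_natCast {a : ℝ} (ha : 0 < a) (n : ℕ) :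
    Real.Gamma (a + n) = (ascPochhammer ℝ n).eval a * Real.Gamma a := by
  induction n with
  | zero => simp
  | succ n ih =>
    rw [ascPochhammer_succ_eval, Nat.cast_succ, ← add_assoc, Real.Gamma_add_one (by positivity), ih]
    ring

lemma ascPochhammer_eval_add (a : ℝ) (m n : ℕ) :
    (ascPochhammer ℝ (m + n)).eval a =
      (ascPochhammer ℝ m).eval a * (ascPochhammer ℝ n).eval (a + m) := by
  simp [← ascPochhammer_mul]

lemma choose_eq_ascPochhammer_div (a : ℝ) (n : ℕ) :
    Ring.choose (a + n - 1) n = (ascPochhammer ℝ n).eval a / n.factorial := by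
  have h := Ring.factorial_nsmul_multichoose_eq_ascPochhammer a n
  rw [Ring.multichoose_eq, Polynomial.ascPochhammer_smeval_eq_eval, nsmul_eq_mul] at h
  rw [← h]
  field_simp

lemma choose_pos {a : ℝ} (ha : 0 < a) (n : ℕ) : 0 < Ring.choose (a + n - 1) n := by
  rw [choose_eq_ascPochhammer_div]
  have := ascPochhammer_pos n a ha
  positivity

lemma hasSum_choose_mul_pow (a : ℝ) {z : ℝ} (hz : |z| < 1) :
    HasSum (fun k : ℕ => Ring.choose (a + k - 1) k * z ^ k) ((1 - z) ^ (-a)) := by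
  have h := (Real.one_div_one_sub_rpow_hasFPowerSeriesOnBall_zero a).hasSum (y := z)
    (by simpa [← ofReal_norm] using hz)
  have hpos : 0 < 1 - z := by linarith [(abs_lt.mp hz).2]
  rw [zero_add, one_div, ← Real.rpow_neg hpos.le] at h
  simpa [FormalMultilinearSeries.ofScalars, List.prod_ofFn, mul_comm] using h

end Pochhammer

section LaplaceUniqueness

lemma integral_eq_of_mem_span {E : Type*} [MeasurableSpace E] [TopologicalSpace E]
    [OpensMeasurableSpace E] {P P' : Measure E} [IsFiniteMeasure P] [IsFiniteMeasure P']
    {S : Set (BoundedContinuousFunction E ℝ)} (h : ∀ f ∈ S, ∫ x, f x ∂P = ∫ x, f x ∂P')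
    {g : BoundedContinuousFunction E ℝ} (hg : g ∈ Submodule.span ℝ S) :
    ∫ x, g x ∂P = ∫ x, g x ∂P' := by
  induction hg using Submodule.span_induction with
  | mem f hf => exact h f hf
  | zero => simp
  | add f g _ _ ihf ihg =>
    simp only [BoundedContinuousFunction.coe_add, Pi.add_apply]
    rw [integral_add (f.integrable P) (g.integrable P), integral_add (f.integrable P')
      (g.integrable P'), ihf, ihg]
  | smul c f _ ihf =>
    simp only [BoundedContinuousFunction.coe_smul, smul_eq_mul, integral_const_mul, ihf]

lemma ext_of_submonoid_integral_eq {E : Type*} [MeasurableSpace E] [TopologicalSpace E]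
    [PolishSpace E] [BorelSpace E] {P P' : Measure E} [IsFiniteMeasure P] [IsFiniteMeasure P']
    (M : Submonoid (BoundedContinuousFunction E ℝ))
    (hM : ∀ x y : E, x ≠ y → ∃ f ∈ M, f x ≠ f y)
    (h : ∀ f ∈ M, ∫ x, f x ∂P = ∫ x, f x ∂P') : P = P' := by
  let A : StarSubalgebra ℝ (BoundedContinuousFunction E ℝ) :=
    { toSubalgebra := Algebra.adjoin ℝ (M : Set (BoundedContinuousFunction E ℝ))
      star_mem' := fun {f} hf => by
        have hstar : star f = f := by ext; simp
        rwa [hstar] }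
  refine ext_of_forall_mem_subalgebra_integral_eq_of_polish (𝕜 := ℝ) (A := A) ?_ fun g hg => ?_
  · intro x y hxy
    obtain ⟨f, hf, hne⟩ := hM x y hxy
    exact ⟨f, ⟨BoundedContinuousFunction.toContinuousMapStarₐ ℝ f,
      ⟨f, Algebra.subset_adjoin hf, rfl⟩, rfl⟩, hne⟩
  · have hspan : g ∈ Subalgebra.toSubmodule
        (Algebra.adjoin ℝ (M : Set (BoundedContinuousFunction E ℝ))) := hg
    rw [Algebra.adjoin_eq_span, Submonoid.closure_eq] at hspan
    exact integral_eq_of_mem_span h hspan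

lemma map_coe_map_toNNReal {ι : Type*} {Q : Measure (ι → ℝ)} (hQ : ∀ᵐ x ∂Q, ∀ i, 0 ≤ x i) :
    (Q.map fun x i => (x i).toNNReal).map (fun x i => (x i : ℝ)) = Q := by
  rw [Measure.map_map (by fun_prop) (by fun_prop)]
  conv_rhs => rw [← Measure.map_id (μ := Q)]
  refine Measure.map_congr ?_
  filter_upwards [hQ] with x hx
  funext i
  simp [hx i]

variable {ι : Type*} [Fintype ι]

/-- The exponential `x ↦ exp (-∑ tᵢ xᵢ)` on the orthant `[0, ∞)^ι`, as a bounded continuous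
function; its integral against a measure is the Laplace transform at `t`. -/
noncomputable def orthantExp (t : ι → NNReal) : BoundedContinuousFunction (ι → NNReal) ℝ :=
  BoundedContinuousFunction.ofNormedAddCommGroup
    (fun x => Real.exp (-∑ i, (t i : ℝ) * x i)) (by fun_prop) 1 (fun x => by
      rw [Real.norm_eq_abs, Real.abs_exp, Real.exp_le_one_iff, neg_nonpos]
      positivity)

lemma orthantExp_apply (t x : ι → NNReal) :
    orthantExp t x = Real.exp (-∑ i, (t i : ℝ) * x i) := rfl

/-- The multiplicative monoid of the functions `orthantExp t`. -/
noncomputable def orthantExpSubmonoid (ι : Type*) [Fintype ι] :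
    Submonoid (BoundedContinuousFunction (ι → NNReal) ℝ) where
  carrier := range orthantExp
  one_mem' := ⟨0, by ext x; simp [orthantExp_apply]⟩
  mul_mem' := by
    rintro _ _ ⟨s, rfl⟩ ⟨t, rfl⟩
    refine ⟨s + t, ?_⟩
    ext x
    simp only [orthantExp_apply, BoundedContinuousFunction.coe_mul, Pi.mul_apply, Pi.add_apply,
      NNReal.coe_add, add_mul, Finset.sum_add_distrib, neg_add, Real.exp_add]

lemma exists_orthantExp_apply_ne {x y : ι → NNReal} (hxy : x ≠ y) :
    ∃ f ∈ orthantExpSubmonoid ι, f x ≠ f y := by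
  classical
  obtain ⟨i, hi⟩ := Function.ne_iff.mp hxy
  refine ⟨_, ⟨Pi.single i 1, rfl⟩, ?_⟩
  simpa [orthantExp_apply, Pi.single_apply, apply_ite, ite_mul] using hi

lemma ext_of_integral_orthantExp_eq {P P' : Measure (ι → NNReal)} [IsFiniteMeasure P]
    [IsFiniteMeasure P'] (h : ∀ t, ∫ x, orthantExp t x ∂P = ∫ x, orthantExp t x ∂P') : P = P' := by
  refine ext_of_submonoid_integral_eq (orthantExpSubmonoid ι)
    (fun _ _ => exists_orthantExp_apply_ne) ?_
  rintro _ ⟨t, rfl⟩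
  exact h t

lemma integral_orthantExp_map_toNNReal {Q : Measure (ι → ℝ)} (hQ : ∀ᵐ x ∂Q, ∀ i, 0 ≤ x i)
    (t : ι → NNReal) :
    ∫ x, orthantExp t x ∂(Q.map fun x i => (x i).toNNReal) =
      ∫ x, Real.exp (-∑ i, (t i : ℝ) * x i) ∂Q := by
  rw [integral_map (Measurable.aemeasurable (by fun_prop))
    (orthantExp t).continuous.aestronglyMeasurable]
  refine integral_congr_ae ?_
  filter_upwards [hQ] with x hx
  simp only [orthantExp_apply, Real.coe_toNNReal _ (hx _)]

theorem ext_of_laplace {P P' : Measure (ι → ℝ)} [IsFiniteMeasure P] [IsFiniteMeasure P']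
    (hP : ∀ᵐ x ∂P, ∀ i, 0 ≤ x i) (hP' : ∀ᵐ x ∂P', ∀ i, 0 ≤ x i)
    (h : ∀ t : ι → ℝ, (∀ i, 0 ≤ t i) →
      ∫ x, Real.exp (-∑ i, t i * x i) ∂P = ∫ x, Real.exp (-∑ i, t i * x i) ∂P') : P = P' := by
  rw [← map_coe_map_toNNReal hP, ← map_coe_map_toNNReal hP']
  congr 1
  refine ext_of_integral_orthantExp_eq fun t => ?_
  rw [integral_orthantExp_map_toNNReal hP, integral_orthantExp_map_toNNReal hP']
  exact h _ fun i => (t i).2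

theorem ext_of_laplace_real {P P' : Measure ℝ} [IsFiniteMeasure P] [IsFiniteMeasure P']
    (hP : ∀ᵐ x ∂P, 0 ≤ x) (hP' : ∀ᵐ x ∂P', 0 ≤ x)
    (h : ∀ s : ℝ, 0 ≤ s →
      ∫ x, Real.exp (-(s * x)) ∂P = ∫ x, Real.exp (-(s * x)) ∂P') : P = P' := by
  let e := MeasurableEquiv.funUnique Unit ℝ
  have hnonneg {Q : Measure ℝ} (hQ : ∀ᵐ x ∂Q, 0 ≤ x) : ∀ᵐ x ∂Q.map e.symm, ∀ i, 0 ≤ x i := by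
    rw [e.symm.measurableEmbedding.ae_map_iff]
    exact hQ.mono fun x hx _ => hx
  refine e.symm.map_measurableEquiv_injective
    (ext_of_laplace (hnonneg hP) (hnonneg hP') fun t ht => ?_)
  rw [e.symm.measurableEmbedding.integral_map, e.symm.measurableEmbedding.integral_map]
  simpa using! h (t ()) (ht ())

end LaplaceUniqueness

section GammaMeasure

lemma integrable_of_lintegral_ofReal_eq {Ω : Type*} [MeasurableSpace Ω] {μ : Measure Ω} {f : Ω → ℝ}
    (hfm : AEStronglyMeasurable f μ) (hf : 0 ≤ᵐ[μ] f) {c : ℝ}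
    (h : ∫⁻ x, ENNReal.ofReal (f x) ∂μ = ENNReal.ofReal c) : Integrable f μ :=
  (lintegral_ofReal_ne_top_iff_integrable hfm hf).mp (h ▸ ENNReal.ofReal_ne_top)

lemma integral_eq_of_lintegral_ofReal_eq {Ω : Type*} [MeasurableSpace Ω] {μ : Measure Ω} {f : Ω → ℝ}
    (hfm : AEStronglyMeasurable f μ) (hf : 0 ≤ᵐ[μ] f) {c : ℝ} (hc : 0 ≤ c)
    (h : ∫⁻ x, ENNReal.ofReal (f x) ∂μ = ENNReal.ofReal c) : ∫ x, f x ∂μ = c := by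
  rw [integral_eq_lintegral_of_nonneg_ae hf hfm, h, ENNReal.toReal_ofReal hc]

lemma gammaPDFReal_mul_pow {a r x : ℝ} (ha : 0 < a) (hr : 0 < r) (hx : 0 < x) (m : ℕ) :
    gammaPDFReal a r x * x ^ m =
      (ascPochhammer ℝ m).eval a / r ^ m * gammaPDFReal (a + m) r x := by
  have hp := ascPochhammer_pos m a ha
  have := Real.Gamma_pos_of_pos ha
  rw [gammaPDFReal, gammaPDFReal, if_pos hx.le, if_pos hx.le, Gamma_add_natCast ha,
    Real.rpow_add hr, Real.rpow_natCast, add_sub_right_comm, Real.rpow_add hx, Real.rpow_natCast]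
  field_simp

lemma gammaPDFReal_mul_exp {a r s : ℝ} (hr : 0 < r) (hs : 0 < r + s) (x : ℝ) :
    gammaPDFReal a r x * Real.exp (-(s * x)) =
      (r / (r + s)) ^ a * gammaPDFReal a (r + s) x := by
  unfold gammaPDFReal
  split_ifs with h
  · have hne : (r + s) ^ a ≠ 0 := (Real.rpow_pos_of_pos hs a).ne'
    rw [Real.div_rpow hr.le hs.le, mul_assoc, ← Real.exp_add, ← neg_add, ← add_mul]
    field_simp
  · simp

@[fun_prop]
lemma measurable_gammaPDF (a r : ℝ) : Measurable (gammaPDF a r) :=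
  (measurable_gammaPDFReal a r).ennreal_ofReal

lemma ae_pos_gammaMeasure (a r : ℝ) : ∀ᵐ x ∂(gammaMeasure a r), 0 < x := by
  rw [gammaMeasure, ae_withDensity_iff (measurable_gammaPDF a r)]
  filter_upwards [Measure.ae_ne volume (0 : ℝ)] with x hx hpdf
  by_contra! hneg
  exact hpdf (gammaPDF_of_neg (lt_of_le_of_ne hneg hx))

lemma ae_nonneg_gammaMeasure (a r : ℝ) : ∀ᵐ x ∂(gammaMeasure a r), 0 ≤ x :=
  (ae_pos_gammaMeasure a r).mono fun _ => le_of_lt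

lemma gammaMeasure_eq_withDensity_restrict (a r : ℝ) :
    gammaMeasure a r = (volume.restrict (Ioi 0)).withDensity (gammaPDF a r) := by
  rw [← restrict_withDensity measurableSet_Ioi, ← gammaMeasure,
    Measure.restrict_eq_self_of_ae_mem (s := Ioi 0) (ae_pos_gammaMeasure a r)]

lemma lintegral_gammaMeasure (a r : ℝ) (f : ℝ → ENNReal) :
    ∫⁻ x, f x ∂(gammaMeasure a r) = ∫⁻ x in Ioi 0, gammaPDF a r x * f x := by
  rw [gammaMeasure_eq_withDensity_restrict, lintegral_withDensity_eq_lintegral_mul_non_measurable _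
    (measurable_gammaPDF a r) (ae_of_all _ fun x => ENNReal.ofReal_lt_top)]
  rfl

lemma gPdf_nonneg {a : ℝ} (ha : 0 < a) (x : ℝ) : 0 ≤ gPdf a x :=
  gammaPDFReal_nonneg ha one_pos x

lemma integral_gammaMeasure_one {a : ℝ} (ha : 0 < a) (f : ℝ → ℝ) :
    ∫ x, f x ∂(gammaMeasure a 1) = ∫ x in Ioi (0 : ℝ), f x * gPdf a x := by
  rw [gammaMeasure_eq_withDensity_restrict, integral_withDensity_eq_integral_toReal_smul
    (measurable_gammaPDF a 1) (ae_of_all _ fun x => ENNReal.ofReal_lt_top)]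
  simp only [gammaPDF, ENNReal.toReal_ofReal (gammaPDFReal_nonneg ha one_pos _), smul_eq_mul,
    mul_comm, gPdf]

lemma integrable_gammaMeasure_one_iff {a : ℝ} (ha : 0 < a) (f : ℝ → ℝ) :
    Integrable f (gammaMeasure a 1) ↔ IntegrableOn (fun x => f x * gPdf a x) (Ioi (0 : ℝ)) := by
  rw [gammaMeasure_eq_withDensity_restrict, integrable_withDensity_iff_integrable_smul₀'
    (measurable_gammaPDF a 1).aemeasurable (ae_of_all _ fun x => ENNReal.ofReal_lt_top)]
  simp only [gammaPDF, ENNReal.toReal_ofReal (gammaPDFReal_nonneg ha one_pos _), smul_eq_mul,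
    mul_comm, gPdf, IntegrableOn]

lemma prod_gammaMeasure_one_eq_withDensity {a : ℝ} (ha : 0 < a) :
    (gammaMeasure a 1).prod (gammaMeasure a 1) =
      (volume.restrict (Ioi (0 : ℝ) ×ˢ Ioi (0 : ℝ))).withDensity
        fun p => ENNReal.ofReal (gPdf a p.1 * gPdf a p.2) := by
  rw [gammaMeasure_eq_withDensity_restrict, prod_withDensity (measurable_gammaPDF a 1)
    (measurable_gammaPDF a 1), Measure.prod_restrict, ← Measure.volume_eq_prod]
  simp only [gPdf, gammaPDF, ENNReal.ofReal_mul (gammaPDFReal_nonneg ha one_pos _)]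

lemma measurable_gPdf_mul_gPdf (a : ℝ) :
    Measurable fun p : ℝ × ℝ => ENNReal.ofReal (gPdf a p.1 * gPdf a p.2) := by
  have h : Measurable (gPdf a) := measurable_gammaPDFReal a 1
  fun_prop

lemma integral_prod_gammaMeasure_one {a : ℝ} (ha : 0 < a) (f : ℝ × ℝ → ℝ) :
    ∫ p, f p ∂((gammaMeasure a 1).prod (gammaMeasure a 1)) =
      ∫ p in Ioi (0 : ℝ) ×ˢ Ioi (0 : ℝ), f p * gPdf a p.1 * gPdf a p.2 := by
  rw [prod_gammaMeasure_one_eq_withDensity ha, integral_withDensity_eq_integral_toReal_smul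
    (measurable_gPdf_mul_gPdf a) (ae_of_all _ fun p => ENNReal.ofReal_lt_top)]
  simp only [ENNReal.toReal_ofReal (mul_nonneg (gPdf_nonneg ha _) (gPdf_nonneg ha _)),
    smul_eq_mul, mul_comm (gPdf a _ * _), mul_assoc]

lemma integrable_prod_gammaMeasure_one_iff {a : ℝ} (ha : 0 < a) (f : ℝ × ℝ → ℝ) :
    Integrable f ((gammaMeasure a 1).prod (gammaMeasure a 1)) ↔
      IntegrableOn (fun p => f p * gPdf a p.1 * gPdf a p.2) (Ioi (0 : ℝ) ×ˢ Ioi (0 : ℝ)) := by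
  rw [prod_gammaMeasure_one_eq_withDensity ha, integrable_withDensity_iff_integrable_smul₀'
    (measurable_gPdf_mul_gPdf a).aemeasurable (ae_of_all _ fun p => ENNReal.ofReal_lt_top)]
  simp only [ENNReal.toReal_ofReal (mul_nonneg (gPdf_nonneg ha _) (gPdf_nonneg ha _)),
    smul_eq_mul, mul_comm (gPdf a _ * _), mul_assoc, IntegrableOn]

lemma lintegral_pow_mul_gammaMeasure {a r : ℝ} (ha : 0 < a) (hr : 0 < r) (m : ℕ)
    (f : ℝ → ENNReal) :
    ∫⁻ x, ENNReal.ofReal (x ^ m) * f x ∂(gammaMeasure a r) =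
      ENNReal.ofReal ((ascPochhammer ℝ m).eval a / r ^ m) *
        ∫⁻ x, f x ∂(gammaMeasure (a + m) r) := by
  have hp := ascPochhammer_pos m a ha
  rw [lintegral_gammaMeasure, lintegral_gammaMeasure,
    ← lintegral_const_mul' _ _ ENNReal.ofReal_ne_top]
  refine setLIntegral_congr_fun measurableSet_Ioi fun x hx => ?_
  simp only [gammaPDF]
  rw [← mul_assoc, ← mul_assoc, ← ENNReal.ofReal_mul (gammaPDFReal_nonneg ha hr _),
    ← ENNReal.ofReal_mul (by positivity), gammaPDFReal_mul_pow ha hr hx]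

lemma lintegral_exp_gammaMeasure {a r s : ℝ} (ha : 0 < a) (hr : 0 < r) (hs : 0 < r + s) :
    ∫⁻ x, ENNReal.ofReal (Real.exp (-(s * x))) ∂(gammaMeasure a r) =
      ENNReal.ofReal ((r / (r + s)) ^ a) := by
  have hshift (x : ℝ) : gammaPDF a r x * ENNReal.ofReal (Real.exp (-(s * x))) =
      ENNReal.ofReal ((r / (r + s)) ^ a) * gammaPDF a (r + s) x := by
    rw [gammaPDF, gammaPDF, ← ENNReal.ofReal_mul (gammaPDFReal_nonneg ha hr _),
      ← ENNReal.ofReal_mul (by positivity), gammaPDFReal_mul_exp hr hs]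
  have := isProbabilityMeasure_gammaMeasure ha hs
  have hone : ∫⁻ x in Ioi 0, gammaPDF a (r + s) x = 1 := by
    simpa using (lintegral_gammaMeasure a (r + s) 1).symm
  rw [lintegral_gammaMeasure, lintegral_congr hshift,
    lintegral_const_mul' _ _ ENNReal.ofReal_ne_top, hone, mul_one]

lemma lintegral_pow_mul_exp_gammaMeasure {a r s : ℝ} (ha : 0 < a) (hr : 0 < r) (hs : 0 < r + s)
    (m : ℕ) :
    ∫⁻ x, ENNReal.ofReal (x ^ m * Real.exp (-(s * x))) ∂(gammaMeasure a r) =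
      ENNReal.ofReal ((ascPochhammer ℝ m).eval a / r ^ m * (r / (r + s)) ^ (a + m)) := by
  have hp := ascPochhammer_pos m a ha
  simp only [ENNReal.ofReal_mul' (Real.exp_nonneg _)]
  rw [lintegral_pow_mul_gammaMeasure ha hr, lintegral_exp_gammaMeasure (by positivity) hr hs,
    ENNReal.ofReal_mul (by positivity)]

lemma integrable_pow_mul_exp_gammaMeasure {a r s : ℝ} (ha : 0 < a) (hr : 0 < r) (hs : 0 < r + s)
    (m : ℕ) :
    Integrable (fun x => x ^ m * Real.exp (-(s * x))) (gammaMeasure a r) :=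
  integrable_of_lintegral_ofReal_eq (by fun_prop)
    ((ae_pos_gammaMeasure a r).mono fun x hx => by positivity)
    (lintegral_pow_mul_exp_gammaMeasure ha hr hs m)

lemma integral_pow_mul_exp_gammaMeasure {a r s : ℝ} (ha : 0 < a) (hr : 0 < r) (hs : 0 < r + s)
    (m : ℕ) :
    ∫ x, x ^ m * Real.exp (-(s * x)) ∂(gammaMeasure a r) =
      (ascPochhammer ℝ m).eval a / r ^ m * (r / (r + s)) ^ (a + m) := by
  have hp := ascPochhammer_pos m a ha
  exact integral_eq_of_lintegral_ofReal_eq (by fun_prop)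
    ((ae_pos_gammaMeasure a r).mono fun x hx => by positivity) (by positivity)
    (lintegral_pow_mul_exp_gammaMeasure ha hr hs m)

lemma integral_exp_gammaMeasure {a r s : ℝ} (ha : 0 < a) (hr : 0 < r) (hs : 0 < r + s) :
    ∫ x, Real.exp (-(s * x)) ∂(gammaMeasure a r) = (r / (r + s)) ^ a := by
  simpa using integral_pow_mul_exp_gammaMeasure ha hr hs 0

lemma integral_exp_gammaMeasure_one {a s : ℝ} (ha : 0 < a) (hs : 0 < 1 + s) :
    ∫ x, Real.exp (-(s * x)) ∂(gammaMeasure a 1) = (1 + s) ^ (-a) := by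
  rw [integral_exp_gammaMeasure ha one_pos hs, one_div, Real.inv_rpow hs.le, Real.rpow_neg hs.le]

lemma integrable_pow_gammaMeasure_one {a : ℝ} (ha : 0 < a) (m : ℕ) :
    Integrable (fun x => x ^ m) (gammaMeasure a 1) := by
  simpa using integrable_pow_mul_exp_gammaMeasure ha one_pos (s := 0) (by norm_num) m

lemma integral_pow_gammaMeasure_one {a : ℝ} (ha : 0 < a) (m : ℕ) :
    ∫ x, x ^ m ∂(gammaMeasure a 1) = (ascPochhammer ℝ m).eval a := by
  simpa using integral_pow_mul_exp_gammaMeasure ha one_pos (s := 0) (by norm_num) m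

lemma map_const_mul_gammaMeasure {a r : ℝ} (ha : 0 < a) (hr : 0 < r) :
    (gammaMeasure a r).map (r * ·) = gammaMeasure a 1 := by
  have := isProbabilityMeasure_gammaMeasure ha hr
  have := isProbabilityMeasure_gammaMeasure ha one_pos
  refine ext_of_laplace_real ?_ (ae_nonneg_gammaMeasure a 1) fun s hs => ?_
  · rw [ae_map_iff (by fun_prop) measurableSet_Ici]
    filter_upwards [ae_pos_gammaMeasure a r] with x hx
    positivity
  · rw [integral_map (by fun_prop) (by fun_prop),
      integral_exp_gammaMeasure ha one_pos (by linarith)]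
    simp only [← mul_assoc]
    rw [integral_exp_gammaMeasure ha hr (by positivity)]
    congr 1
    field_simp

lemma gammaMeasure_Iic {a r : ℝ} (ha : 0 < a) (hr : 0 < r) (x : ℝ) :
    gammaMeasure a r (Iic x) = ENNReal.ofReal (gCdf a (r * x)) := by
  have := isProbabilityMeasure_gammaMeasure ha one_pos
  rw [gCdf, ofReal_cdf, ← map_const_mul_gammaMeasure ha hr,
    Measure.map_apply (by fun_prop) measurableSet_Iic]
  congr 1
  ext y
  simp [mul_le_mul_iff_right₀ hr]

end GammaMeasure

section ExponentialsDense

lemma norm_exp_neg_mul_le {s x : ℝ} (hs : 0 ≤ s) (hx : 0 ≤ x) : ‖Real.exp (-(s * x))‖ ≤ 1 := by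
  rw [Real.norm_eq_abs, Real.abs_exp, Real.exp_le_one_iff, neg_nonpos]
  positivity

lemma integral_withDensity_ofReal {Ω : Type*} [MeasurableSpace Ω] {μ : Measure Ω} {f : Ω → ℝ}
    (hf : AEMeasurable f μ) (g : Ω → ℝ) :
    ∫ x, g x ∂(μ.withDensity fun x => ENNReal.ofReal (f x)) = ∫ x, max (f x) 0 * g x ∂μ := by
  rw [integral_withDensity_eq_integral_toReal_smul₀ hf.ennreal_ofReal
    (ae_of_all _ fun _ => ENNReal.ofReal_lt_top)]
  simp only [ENNReal.toReal_ofReal', smul_eq_mul]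

lemma integral_withDensity_ofReal_sub {Ω : Type*} [MeasurableSpace Ω] {μ : Measure Ω}
    {f g : Ω → ℝ} (hf : Integrable f μ) (hg : AEStronglyMeasurable g μ) {c : ℝ}
    (hc : ∀ᵐ x ∂μ, ‖g x‖ ≤ c) :
    ∫ x, g x ∂(μ.withDensity fun x => ENNReal.ofReal (f x)) -
        ∫ x, g x ∂(μ.withDensity fun x => ENNReal.ofReal (-f x)) = ∫ x, g x * f x ∂μ := by
  rw [integral_withDensity_ofReal hf.aemeasurable,
    integral_withDensity_ofReal (f := fun x => -f x) hf.aemeasurable.neg,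
    ← integral_sub (hf.pos_part.mul_bdd hg hc) (hf.neg_part.mul_bdd hg hc)]
  refine integral_congr_ae (ae_of_all _ fun x => ?_)
  simp only [← sub_mul, max_zero_sub_max_neg_zero_eq_self, mul_comm (g _)]

/-- The elements of `L²(γ)` represented by an exponential `x ↦ exp (-s x)`, `s ≥ 0`. -/
def expClasses (γ : Measure ℝ) : Set (Lp ℝ 2 γ) :=
  {g | ∃ s : ℝ, 0 ≤ s ∧ g =ᵐ[γ] fun x => Real.exp (-(s * x))}

variable {γ : Measure ℝ}

lemma ae_eq_zero_of_laplace_eq_zero (hγ : ∀ᵐ x ∂γ, 0 ≤ x) {f : ℝ → ℝ} (hf : Integrable f γ)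
    (h : ∀ s : ℝ, 0 ≤ s → ∫ x, Real.exp (-(s * x)) * f x ∂γ = 0) : f =ᵐ[γ] 0 := by
  have := isFiniteMeasure_withDensity_ofReal hf.2
  have := isFiniteMeasure_withDensity_ofReal hf.neg.2
  have hparts : γ.withDensity (fun x => ENNReal.ofReal (f x)) =
      γ.withDensity (fun x => ENNReal.ofReal (-f x)) := by
    refine ext_of_laplace_real ((withDensity_absolutelyContinuous _ _).ae_le hγ)
      ((withDensity_absolutelyContinuous _ _).ae_le hγ) fun s hs => ?_
    rw [← sub_eq_zero, integral_withDensity_ofReal_sub hf (by fun_prop)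
      (hγ.mono fun x hx => norm_exp_neg_mul_le hs hx), h s hs]
  have hae := (withDensity_eq_iff hf.aemeasurable.ennreal_ofReal
    hf.neg.aemeasurable.ennreal_ofReal hf.lintegral_lt_top.ne).mp hparts
  filter_upwards [hae] with x hx
  have hmax := congrArg ENNReal.toReal hx
  simp only [ENNReal.toReal_ofReal', Pi.neg_apply] at hmax
  rw [← max_zero_sub_max_neg_zero_eq_self (f x), hmax, sub_self, Pi.zero_apply]

variable [IsFiniteMeasure γ]

lemma memLp_exp (hγ : ∀ᵐ x ∂γ, 0 ≤ x) {s : ℝ} (hs : 0 ≤ s) (p : ENNReal) :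
    MemLp (fun x => Real.exp (-(s * x))) p γ :=
  MemLp.of_bound (by fun_prop) 1 (hγ.mono fun _ hx => norm_exp_neg_mul_le hs hx)

theorem dense_span_expClasses (hγ : ∀ᵐ x ∂γ, 0 ≤ x) :
    Dense (Submodule.span ℝ (expClasses γ) : Set (Lp ℝ 2 γ)) := by
  rw [Submodule.dense_iff_topologicalClosure_eq_top, Submodule.topologicalClosure_eq_top_iff,
    Submodule.eq_bot_iff]
  intro f hf
  have hfi : Integrable f γ := (Lp.memLp f).integrable one_le_two
  refine Lp.eq_zero_iff_ae_eq_zero.mpr (ae_eq_zero_of_laplace_eq_zero hγ hfi fun s hs => ?_)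
  have hexp := memLp_exp hγ hs 2
  have horth : inner ℝ hexp.toLp f = 0 :=
    (Submodule.mem_orthogonal _ _).mp hf _ (Submodule.subset_span ⟨s, hs, hexp.coeFn_toLp⟩)
  rw [← horth, L2.inner_def]
  refine integral_congr_ae ?_
  filter_upwards [hexp.coeFn_toLp] with x hx
  simp [hx, mul_comm]

end ExponentialsDense

section Laguerre

open Polynomial

lemma sum_neg_one_pow_mul_choose_mul (f : ℝ → ℝ) (k : ℕ) :
    ∑ m ∈ Finset.range (k + 1), (-1) ^ m * (k.choose m : ℝ) * f m =
      (-1) ^ k * (fwdDiff 1)^[k] f 0 := by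
  rw [fwdDiff_iter_eq_sum_shift, Finset.mul_sum]
  refine Finset.sum_congr rfl fun m hm => ?_
  have hsign : (-1 : ℝ) ^ m = (-1) ^ k * (-1) ^ (k - m) := by
    obtain ⟨d, rfl⟩ := Nat.exists_eq_add_of_le (Nat.lt_succ_iff.mp (Finset.mem_range.mp hm))
    rw [add_tsub_cancel_left, pow_add, mul_assoc, ← mul_pow, neg_mul_neg, one_mul, one_pow, mul_one]
  simp only [zsmul_eq_mul, Int.cast_mul, Int.cast_pow, Int.cast_neg, Int.cast_one,
    Int.cast_natCast, zero_add, nsmul_eq_mul, mul_one]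
  rw [hsign]
  ring

lemma sum_neg_one_pow_mul_choose_mul_eval {P : ℝ[X]} (hP : P.Monic) {k : ℕ}
    (hk : P.natDegree ≤ k) :
    ∑ m ∈ Finset.range (k + 1), (-1) ^ m * (k.choose m : ℝ) * P.eval (m : ℝ) =
      if P.natDegree = k then (-1 : ℝ) ^ k * k.factorial else 0 := by
  rw [sum_neg_one_pow_mul_choose_mul P.eval]
  split_ifs with h
  · subst h
    rw [Polynomial.fwdDiff_iter_degree_eq_factorial, hP.leadingCoeff, one_smul, Pi.natCast_apply]
  · rw [Polynomial.fwdDiff_iter_eq_zero_of_degree_lt (lt_of_le_of_ne hk h), Pi.zero_apply, mul_zero]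

variable {α : ℝ}

lemma laguerre_eq_sum (hα : 0 < α) (k : ℕ) (y : ℝ) :
    laguerre (α - 1) k y = ∑ m ∈ Finset.range (k + 1),
      Ring.choose (α + k - 1) k * ((-1) ^ m * (k.choose m : ℝ) / (ascPochhammer ℝ m).eval α) *
        y ^ m := by
  refine Finset.sum_congr rfl fun m hm => ?_
  have hmk : m ≤ k := Nat.lt_succ_iff.mp (Finset.mem_range.mp hm)
  have hchoose : Ring.choose ((k : ℝ) + (α - 1)) (k - m) =
      (ascPochhammer ℝ (k - m)).eval (α + m) / (k - m).factorial := by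
    rw [← choose_eq_ascPochhammer_div, Nat.cast_sub hmk]
    congr 1
    ring
  have hsplit := ascPochhammer_eval_add α m (k - m)
  rw [Nat.add_sub_cancel' hmk] at hsplit
  have hpos := ascPochhammer_pos m α hα
  rw [hchoose, choose_eq_ascPochhammer_div, hsplit, Nat.cast_choose ℝ hmk]
  field_simp

lemma integral_laguerre_mul (hα : 0 < α) (k : ℕ) {f : ℝ → ℝ}
    (hf : ∀ m : ℕ, Integrable (fun y => y ^ m * f y) (gammaMeasure α 1)) :
    ∫ y, laguerre (α - 1) k y * f y ∂(gammaMeasure α 1) =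
      Ring.choose (α + k - 1) k * ∑ m ∈ Finset.range (k + 1), (-1) ^ m * (k.choose m : ℝ) *
        ((∫ y, y ^ m * f y ∂(gammaMeasure α 1)) / (ascPochhammer ℝ m).eval α) := by
  simp only [laguerre_eq_sum hα, Finset.sum_mul, mul_assoc _ (_ ^ _) (f _)]
  rw [integral_finsetSum _ fun m _ => (hf m).const_mul _, Finset.mul_sum]
  simp only [integral_const_mul]
  exact Finset.sum_congr rfl fun m _ => by ring

lemma integral_laguerre_mul_exp (hα : 0 < α) {s : ℝ} (hs : 0 ≤ s) (k : ℕ) :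
    ∫ y, laguerre (α - 1) k y * Real.exp (-(s * y)) ∂(gammaMeasure α 1) =
      Ring.choose (α + k - 1) k * ((1 + s) ^ (-α) * (s / (1 + s)) ^ k) := by
  have hs1 : 0 < 1 + s := by linarith
  have hbase : s / (1 + s) = -(1 / (1 + s)) + 1 := by field_simp; ring
  rw [integral_laguerre_mul hα k (integrable_pow_mul_exp_gammaMeasure hα one_pos hs1), hbase,
    add_pow]
  congr 1
  rw [Finset.mul_sum]
  refine Finset.sum_congr rfl fun m _ => ?_
  have hpos := ascPochhammer_pos m α hα
  rw [integral_pow_mul_exp_gammaMeasure hα one_pos hs1, Real.rpow_add (by positivity),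
    Real.rpow_natCast, Real.rpow_neg hs1.le, Real.div_rpow zero_le_one hs1.le, Real.one_rpow,
    neg_pow (1 / (1 + s))]
  field_simp
  simp

-- The moments turn the integral into the `k`-th finite difference of a monic polynomial of degree
-- `j`.
lemma integral_laguerre_mul_pow_of_le (hα : 0 < α) {j k : ℕ} (hjk : j ≤ k) :
    ∫ y, laguerre (α - 1) k y * y ^ j ∂(gammaMeasure α 1) =
      if j = k then Ring.choose (α + k - 1) k * ((-1) ^ k * k.factorial) else 0 := by
  set P : ℝ[X] := (ascPochhammer ℝ j).comp (X + C α)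
  have hmonic : P.Monic := (monic_ascPochhammer ℝ j).comp_X_add_C α
  have hdeg : P.natDegree = j := by
    rw [natDegree_comp, natDegree_X_add_C, ascPochhammer_natDegree, mul_one]
  have hmoment (m : ℕ) : (∫ y, y ^ m * y ^ j ∂(gammaMeasure α 1)) / (ascPochhammer ℝ m).eval α =
      P.eval (m : ℝ) := by
    have hpos := ascPochhammer_pos m α hα
    simp only [← pow_add]
    rw [integral_pow_gammaMeasure_one hα, ascPochhammer_eval_add, mul_div_cancel_left₀ _ hpos.ne']
    simp [P, add_comm]
  have hint (m : ℕ) : Integrable (fun y : ℝ => y ^ m * y ^ j) (gammaMeasure α 1) := by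
    simpa only [← pow_add] using integrable_pow_gammaMeasure_one hα (m + j)
  rw [integral_laguerre_mul hα k hint]
  simp only [hmoment, sum_neg_one_pow_mul_choose_mul_eval hmonic (hdeg.trans_le hjk), hdeg,
    mul_ite, mul_zero]

lemma memLp_pow_gammaMeasure_one (hα : 0 < α) (m : ℕ) :
    MemLp (fun y : ℝ => y ^ m) 2 (gammaMeasure α 1) := by
  rw [memLp_two_iff_integrable_sq (by fun_prop)]
  simpa only [← pow_mul] using integrable_pow_gammaMeasure_one hα _

lemma memLp_laguerre (hα : 0 < α) (k : ℕ) :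
    MemLp (laguerre (α - 1) k) 2 (gammaMeasure α 1) := by
  rw [funext (laguerre_eq_sum hα k)]
  exact memLp_finsetSum _ fun m _ => (memLp_pow_gammaMeasure_one hα m).const_mul _

lemma integral_laguerre_mul_laguerre_of_le (hα : 0 < α) {j k : ℕ} (hjk : j ≤ k) :
    ∫ y, laguerre (α - 1) k y * laguerre (α - 1) j y ∂(gammaMeasure α 1) =
      if j = k then Ring.choose (α + k - 1) k else 0 := by
  have hint (m : ℕ) : Integrable (fun y => laguerre (α - 1) k y * y ^ m) (gammaMeasure α 1) :=
    (memLp_laguerre hα k).integrable_mul (memLp_pow_gammaMeasure_one hα m)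
  simp only [laguerre_eq_sum hα j, Finset.mul_sum, mul_left_comm (laguerre _ _ _)]
  rw [integral_finsetSum _ fun m _ => (hint m).const_mul _]
  simp only [integral_const_mul]
  rw [Finset.sum_congr rfl fun m hm => by rw [integral_laguerre_mul_pow_of_le hα
    ((Nat.lt_succ_iff.mp (Finset.mem_range.mp hm)).trans hjk)]]
  simp only [mul_ite, mul_zero, Finset.sum_ite_eq', Finset.mem_range, Order.lt_add_one_iff]
  rcases hjk.eq_or_lt with rfl | hlt
  · have hpos := ascPochhammer_pos j α hα
    simp only [le_refl, if_true, Nat.choose_self, choose_eq_ascPochhammer_div]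
    field_simp
    simp [← pow_mul]
  · simp [hlt.ne, hlt.not_ge]

/-- The orthonormalized Laguerre polynomials in `L²` of the gamma distribution. -/
noncomputable def laguerreLp (hα : 0 < α) (k : ℕ) : Lp ℝ 2 (gammaMeasure α 1) :=
  (Real.sqrt (Ring.choose (α + k - 1) k))⁻¹ • (memLp_laguerre hα k).toLp

lemma inner_laguerreLp (hα : 0 < α) (k : ℕ) {f : ℝ → ℝ} {g : Lp ℝ 2 (gammaMeasure α 1)}
    (hg : g =ᵐ[gammaMeasure α 1] f) :
    inner ℝ (laguerreLp hα k) g = (Real.sqrt (Ring.choose (α + k - 1) k))⁻¹ *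
      ∫ y, laguerre (α - 1) k y * f y ∂(gammaMeasure α 1) := by
  rw [laguerreLp, inner_smul_left, L2.inner_def]
  simp only [conj_trivial]
  congr 1
  refine integral_congr_ae ?_
  filter_upwards [(memLp_laguerre hα k).coeFn_toLp, hg] with y hL hf
  simp [hL, hf, mul_comm]

lemma inner_laguerreLp_of_le (hα : 0 < α) {j k : ℕ} (hjk : j ≤ k) :
    inner ℝ (laguerreLp hα k) (laguerreLp hα j) = if j = k then (1 : ℝ) else 0 := by
  rw [laguerreLp.eq_1 hα j, inner_smul_right,
    inner_laguerreLp hα k (memLp_laguerre hα j).coeFn_toLp,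
    integral_laguerre_mul_laguerre_of_le hα hjk]
  split_ifs with h
  · subst h
    have hpos := choose_pos hα j
    rw [← mul_assoc, ← mul_inv, Real.mul_self_sqrt hpos.le, inv_mul_cancel₀ hpos.ne']
  · simp

lemma orthonormal_laguerreLp (hα : 0 < α) : Orthonormal ℝ (laguerreLp hα) := by
  refine orthonormal_iff_ite.mpr fun k j => ?_
  rcases le_total j k with h | h
  · simpa only [eq_comm] using inner_laguerreLp_of_le hα h
  · rw [real_inner_comm]
    exact inner_laguerreLp_of_le hα h

end Laguerre

section WeightedForm

variable {ι E : Type*} [NormedAddCommGroup E] [InnerProductSpace ℝ E] {e : ι → E} {w : ι → ℝ}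

lemma sum_abs_weighted_inner_le (he : Orthonormal ℝ e) (hw : ∀ k, |w k| ≤ 1) (f g : E)
    (s : Finset ι) :
    ∑ k ∈ s, |w k * (inner ℝ (e k) f * inner ℝ (e k) g)| ≤ ‖f‖ * ‖g‖ := by
  calc ∑ k ∈ s, |w k * (inner ℝ (e k) f * inner ℝ (e k) g)|
      ≤ ∑ k ∈ s, |inner ℝ (e k) f| * |inner ℝ (e k) g| := by
        refine Finset.sum_le_sum fun k _ => ?_
        rw [abs_mul, abs_mul]
        exact mul_le_of_le_one_left (by positivity) (hw k)
    _ ≤ ‖f‖ * ‖g‖ := by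
        refine le_of_sq_le_sq ?_ (by positivity)
        rw [mul_pow]
        exact (Finset.sum_mul_sq_le_sq_mul_sq _ _ _).trans <|
          mul_le_mul (he.sum_inner_products_le f) (he.sum_inner_products_le g)
            (by positivity) (by positivity)

lemma summable_weighted_inner (he : Orthonormal ℝ e) (hw : ∀ k, |w k| ≤ 1) (f g : E) :
    Summable fun k => w k * (inner ℝ (e k) f * inner ℝ (e k) g) :=
  .of_abs <| summable_of_sum_le (fun _ => abs_nonneg _) (sum_abs_weighted_inner_le he hw f g)

lemma abs_tsum_weighted_inner_le (he : Orthonormal ℝ e) (hw : ∀ k, |w k| ≤ 1) (f g : E) :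
    |∑' k, w k * (inner ℝ (e k) f * inner ℝ (e k) g)| ≤ ‖f‖ * ‖g‖ := by
  have hsum := summable_weighted_inner he hw f g
  exact (norm_tsum_le_tsum_norm hsum.norm).trans
    (hsum.norm.tsum_le_of_sum_le (sum_abs_weighted_inner_le he hw f g))

/-- The continuous bilinear form `(f, g) ↦ ∑ₖ wₖ ⟪eₖ, f⟫ ⟪eₖ, g⟫` of an orthonormal family `e` and
weights `|wₖ| ≤ 1`, used for Mercer-type expansions. -/
noncomputable def weightedForm (he : Orthonormal ℝ e) (hw : ∀ k, |w k| ≤ 1) :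
    E →L[ℝ] E →L[ℝ] ℝ :=
  LinearMap.mkContinuous₂
    (LinearMap.mk₂ ℝ (fun f g => ∑' k, w k * (inner ℝ (e k) f * inner ℝ (e k) g))
      (fun f f' g => by
        rw [← (summable_weighted_inner he hw f g).tsum_add (summable_weighted_inner he hw f' g)]
        exact tsum_congr fun k => by rw [inner_add_right]; ring)
      (fun c f g => by
        rw [smul_eq_mul, ← tsum_mul_left]
        exact tsum_congr fun k => by rw [inner_smul_right]; ring)
      (fun f g g' => by
        rw [← (summable_weighted_inner he hw f g).tsum_add (summable_weighted_inner he hw f g')]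
        exact tsum_congr fun k => by rw [inner_add_right]; ring)
      (fun c f g => by
        rw [smul_eq_mul, ← tsum_mul_left]
        exact tsum_congr fun k => by rw [inner_smul_right]; ring))
    1 (fun f g => (abs_tsum_weighted_inner_le he hw f g).trans_eq (by rw [one_mul]))

lemma weightedForm_apply (he : Orthonormal ℝ e) (hw : ∀ k, |w k| ≤ 1) (f g : E) :
    weightedForm he hw f g = ∑' k, w k * (inner ℝ (e k) f * inner ℝ (e k) g) := rfl

end WeightedForm

section CouplingForm

variable {Ω : Type*} [MeasurableSpace Ω] {γ₁ γ₂ : Measure Ω} {ν : Measure (Ω × Ω)}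

/-- The bilinear form `(f, g) ↦ ∫ f(y₁) g(y₂) dν` on `L²(γ₁) × L²(γ₂)` of a coupling `ν`. -/
noncomputable def couplingForm (h₁ : MeasurePreserving Prod.fst ν γ₁)
    (h₂ : MeasurePreserving Prod.snd ν γ₂) : Lp ℝ 2 γ₁ →L[ℝ] Lp ℝ 2 γ₂ →L[ℝ] ℝ :=
  (innerSL ℝ (E := Lp ℝ 2 ν)).bilinearComp
    (Lp.compMeasurePreservingₗᵢ ℝ Prod.fst h₁).toContinuousLinearMap
    (Lp.compMeasurePreservingₗᵢ ℝ Prod.snd h₂).toContinuousLinearMap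

lemma couplingForm_apply (h₁ : MeasurePreserving Prod.fst ν γ₁)
    (h₂ : MeasurePreserving Prod.snd ν γ₂) {F : Lp ℝ 2 γ₁} {G : Lp ℝ 2 γ₂} {f g : Ω → ℝ}
    (hf : F =ᵐ[γ₁] f) (hg : G =ᵐ[γ₂] g) :
    couplingForm h₁ h₂ F G = ∫ p, f p.1 * g p.2 ∂ν := by
  change inner ℝ (Lp.compMeasurePreserving Prod.fst h₁ F)
    (Lp.compMeasurePreserving Prod.snd h₂ G) = _
  rw [L2.inner_def]
  refine integral_congr_ae ?_
  filter_upwards [Lp.coeFn_compMeasurePreserving F h₁, Lp.coeFn_compMeasurePreserving G h₂,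
    h₁.quasiMeasurePreserving.ae_eq_comp hf, h₂.quasiMeasurePreserving.ae_eq_comp hg]
    with p hF hG hFf hGg
  simp only [hF, hG, hFf, hGg, Function.comp_apply, RCLike.inner_apply, conj_trivial, mul_comm]

end CouplingForm

section Kibble

variable {α ρ s t : ℝ}

lemma hasSum_choose_mul_rpow_mul_pow (α : ℝ) {c z : ℝ} (hz : |z| < c) :
    HasSum (fun k : ℕ => Ring.choose (α + k - 1) k * (c ^ (-α) * (z / c) ^ k))
      ((c - z) ^ (-α)) := by
  have hc : 0 < c := (abs_nonneg z).trans_lt hz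
  have hzc : |z / c| < 1 := by rwa [abs_div, abs_of_pos hc, div_lt_one hc]
  have hsub : c - z = c * (1 - z / c) := by field_simp
  rw [hsub, Real.mul_rpow hc.le (by linarith [(abs_lt.mp hzc).2])]
  exact ((hasSum_choose_mul_pow α hzc).mul_left (c ^ (-α))).congr_fun fun k => by ring

/-- `ν` is Kibble's bivariate gamma distribution with correlation `ρ`, characterized by its
Laplace transform. -/
structure IsKibbleLaw (α ρ : ℝ) (ν : Measure (ℝ × ℝ)) : Prop where
  isProbabilityMeasure : IsProbabilityMeasure ν
  nonneg : ∀ᵐ p ∂ν, 0 ≤ p.1 ∧ 0 ≤ p.2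
  laplace : ∀ s t : ℝ, 0 ≤ s → 0 ≤ t →
    ∫ p, Real.exp (-(s * p.1)) * Real.exp (-(t * p.2)) ∂ν =
      ((1 + s) * (1 + t) - ρ * (s * t)) ^ (-α)

namespace IsKibbleLaw

variable {ν : Measure (ℝ × ℝ)}

lemma measurePreserving_fst (hα : 0 < α) (hν : IsKibbleLaw α ρ ν) :
    MeasurePreserving Prod.fst ν (gammaMeasure α 1) := by
  have := hν.isProbabilityMeasure
  have := isProbabilityMeasure_gammaMeasure hα one_pos
  refine ⟨measurable_fst, ext_of_laplace_real ?_ (ae_nonneg_gammaMeasure α 1) fun s hs => ?_⟩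
  · rw [ae_map_iff measurable_fst.aemeasurable measurableSet_Ici]
    exact hν.nonneg.mono fun p hp => hp.1
  · rw [integral_map (by fun_prop) (by fun_prop), integral_exp_gammaMeasure_one hα (by linarith)]
    simpa using hν.laplace s 0 hs le_rfl

lemma swap (hν : IsKibbleLaw α ρ ν) : IsKibbleLaw α ρ (ν.map Prod.swap) where
  isProbabilityMeasure :=
    have := hν.isProbabilityMeasure
    Measure.isProbabilityMeasure_map (by fun_prop)
  nonneg := (ae_map_iff (by fun_prop) (by measurability)).mpr (hν.nonneg.mono fun _ hp => hp.symm)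
  laplace s t hs ht := by
    rw [integral_map (by fun_prop) (by fun_prop), mul_comm (1 + s), mul_comm s t,
      ← hν.laplace t s ht hs]
    simp only [Prod.fst_swap, Prod.snd_swap, mul_comm]

lemma measurePreserving_snd (hα : 0 < α) (hν : IsKibbleLaw α ρ ν) :
    MeasurePreserving Prod.snd ν (gammaMeasure α 1) :=
  (hν.swap.measurePreserving_fst hα).comp (measurable_swap.measurePreserving ν)

lemma integrable_of_norm_le (hν : IsKibbleLaw α ρ ν) {f : ℝ × ℝ → ℝ}
    (hf : AEStronglyMeasurable f ν) {c : ℝ} (h : ∀ p : ℝ × ℝ, 0 ≤ p.1 → 0 ≤ p.2 → ‖f p‖ ≤ c) :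
    Integrable f ν :=
  have := hν.isProbabilityMeasure
  Integrable.of_bound hf c (hν.nonneg.mono fun p hp => h p hp.1 hp.2)

lemma lintegral_exp (hν : IsKibbleLaw α ρ ν) (hs : 0 ≤ s) (ht : 0 ≤ t) :
    ∫⁻ p, ENNReal.ofReal (Real.exp (-(s * p.1)) * Real.exp (-(t * p.2))) ∂ν =
      ENNReal.ofReal (((1 + s) * (1 + t) - ρ * (s * t)) ^ (-α)) := by
  rw [← hν.laplace s t hs ht, ofReal_integral_eq_lintegral_ofReal _
    (ae_of_all _ fun p => by positivity)]
  refine hν.integrable_of_norm_le (c := 1) (by fun_prop) fun p h1 h2 => ?_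
  rw [norm_mul]
  exact mul_le_one₀ (norm_exp_neg_mul_le hs h1) (norm_nonneg _) (norm_exp_neg_mul_le ht h2)

end IsKibbleLaw

lemma hasSum_kibble_laplace (α : ℝ) (hρ : |ρ| ≤ 1) (hs : 0 ≤ s) (ht : 0 ≤ t) :
    HasSum (fun k : ℕ => Ring.choose (α + k - 1) k * ρ ^ k *
        (((1 + s) ^ (-α) * (s / (1 + s)) ^ k) * ((1 + t) ^ (-α) * (t / (1 + t)) ^ k)))
      (((1 + s) * (1 + t) - ρ * (s * t)) ^ (-α)) := by
  have hst : 0 ≤ s * t := mul_nonneg hs ht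
  have hz : |ρ * (s * t)| < (1 + s) * (1 + t) := by
    rw [abs_mul, abs_of_nonneg hst]
    nlinarith
  refine (hasSum_choose_mul_rpow_mul_pow α hz).congr_fun fun k => ?_
  rw [Real.mul_rpow (by linarith) (by linarith), mul_div_assoc, mul_div_mul_comm, mul_pow, mul_pow]
  ring

lemma abs_pow_le_one (hρ : |ρ| ≤ 1) (k : ℕ) : |ρ ^ k| ≤ 1 :=
  (abs_pow ρ k).trans_le (pow_le_one₀ (abs_nonneg ρ) hρ)

lemma IsKibbleLaw.weightedForm_eq_couplingForm (hα : 0 < α) (hρ : |ρ| ≤ 1)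
    {ν : Measure (ℝ × ℝ)} (hν : IsKibbleLaw α ρ ν) :
    weightedForm (orthonormal_laguerreLp hα) (abs_pow_le_one hρ) =
      couplingForm (hν.measurePreserving_fst hα) (hν.measurePreserving_snd hα) := by
  have := isProbabilityMeasure_gammaMeasure hα one_pos
  have hdense := dense_span_expClasses (ae_nonneg_gammaMeasure α 1)
  refine ContinuousLinearMap.ext_on hdense ?_
  rintro F ⟨s, hs, hF⟩
  refine ContinuousLinearMap.ext_on hdense ?_
  rintro G ⟨t, ht, hG⟩
  rw [couplingForm_apply _ _ hF hG, hν.laplace s t hs ht, weightedForm_apply]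
  refine HasSum.tsum_eq <| (hasSum_kibble_laplace α hρ hs ht).congr_fun fun k => ?_
  have hc := choose_pos hα k
  rw [inner_laguerreLp hα k hF, inner_laguerreLp hα k hG, integral_laguerre_mul_exp hα hs,
    integral_laguerre_mul_exp hα ht]
  field_simp
  rw [Real.sq_sqrt hc.le]

theorem IsKibbleLaw.hasSum_laguerre (hα : 0 < α) (hρ : |ρ| ≤ 1) {ν : Measure (ℝ × ℝ)}
    (hν : IsKibbleLaw α ρ ν) {f g : ℝ → ℝ} (hf : MemLp f 2 (gammaMeasure α 1))
    (hg : MemLp g 2 (gammaMeasure α 1)) :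
    HasSum (fun k : ℕ => (Ring.choose (α + k - 1) k)⁻¹ * ρ ^ k *
        (∫ y, f y * laguerre (α - 1) k y ∂(gammaMeasure α 1)) *
        (∫ y, g y * laguerre (α - 1) k y ∂(gammaMeasure α 1)))
      (∫ p, f p.1 * g p.2 ∂ν) := by
  have he := orthonormal_laguerreLp hα
  have hsum := (summable_weighted_inner he (abs_pow_le_one hρ) hf.toLp hg.toLp).hasSum
  rw [← weightedForm_apply he (abs_pow_le_one hρ), hν.weightedForm_eq_couplingForm hα hρ,
    couplingForm_apply _ _ hf.coeFn_toLp hg.coeFn_toLp] at hsum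
  refine hsum.congr_fun fun k => ?_
  have hc := choose_pos hα k
  rw [inner_laguerreLp hα k hf.coeFn_toLp, inner_laguerreLp hα k hg.coeFn_toLp]
  simp only [mul_comm (laguerre _ _ _)]
  field_simp
  rw [Real.sq_sqrt hc.le]
  ring

lemma isKibbleLaw_map_diag (hα : 0 < α) :
    IsKibbleLaw α 1 ((gammaMeasure α 1).map fun x => (x, x)) where
  isProbabilityMeasure :=
    have := isProbabilityMeasure_gammaMeasure hα one_pos
    Measure.isProbabilityMeasure_map (by fun_prop)
  nonneg := by
    rw [ae_map_iff (by fun_prop) (by measurability)]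
    exact (ae_nonneg_gammaMeasure α 1).mono fun x hx => ⟨hx, hx⟩
  laplace s t hs ht := by
    rw [integral_map (by fun_prop) (by fun_prop)]
    simp only [← Real.exp_add, ← neg_add, ← add_mul]
    rw [integral_exp_gammaMeasure_one hα (by positivity)]
    congr 1
    ring

lemma min_one_le_ascPochhammer_eval (hα : 0 < α) (k : ℕ) :
    min α 1 ≤ (ascPochhammer ℝ k).eval α := by
  induction k with
  | zero => simp
  | succ k ih =>
    rw [ascPochhammer_succ_eval]
    rcases k.eq_zero_or_pos with rfl | hk
    · simp
    · have hk1 : (1 : ℝ) ≤ k := by exact_mod_cast hk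
      exact ih.trans (le_mul_of_one_le_right (ascPochhammer_pos k α hα).le (by linarith))

lemma summable_hyp0F1 (hα : 0 < α) (z : ℝ) :
    Summable fun k : ℕ => z ^ k / ((ascPochhammer ℝ k).eval α * (k.factorial : ℝ)) := by
  have : 0 < min α 1 := by positivity
  refine Summable.of_norm_bounded
    ((Real.summable_pow_div_factorial |z|).mul_left (min α 1)⁻¹) fun k => ?_
  have hpos := ascPochhammer_pos k α hα
  rw [Real.norm_eq_abs, abs_div, abs_pow, abs_of_pos (by positivity : 0 < _ * (k.factorial : ℝ)),
    inv_mul_eq_div, div_div, mul_comm (k.factorial : ℝ)]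
  gcongr
  exact min_one_le_ascPochhammer_eval hα k

lemma hyp0F1_term_nonneg (hα : 0 < α) {z : ℝ} (hz : 0 ≤ z) (k : ℕ) :
    0 ≤ z ^ k / ((ascPochhammer ℝ k).eval α * (k.factorial : ℝ)) := by
  have hpos := ascPochhammer_pos k α hα
  positivity

lemma hyp0F1_nonneg (hα : 0 < α) {z : ℝ} (hz : 0 ≤ z) : 0 ≤ hyp0F1 α z :=
  tsum_nonneg (hyp0F1_term_nonneg hα hz)

lemma measurable_hyp0F1 (hα : 0 < α) : Measurable (hyp0F1 α) := by
  refine measurable_of_tendsto_metrizable (f := fun n z => ∑ k ∈ Finset.range n,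
    z ^ k / ((ascPochhammer ℝ k).eval α * (k.factorial : ℝ))) (fun n => by fun_prop) ?_
  exact tendsto_pi_nhds.mpr fun z => (summable_hyp0F1 hα z).hasSum.tendsto_sum_nat

lemma ofReal_hyp0F1_mul_mul (hα : 0 < α) (hρ : 0 ≤ ρ) {x y : ℝ} (hx : 0 ≤ x) (hy : 0 ≤ y) :
    ENNReal.ofReal (hyp0F1 α (ρ * x * y)) =
      ∑' k : ℕ, ENNReal.ofReal (ρ ^ k / ((ascPochhammer ℝ k).eval α * (k.factorial : ℝ))) *
        (ENNReal.ofReal (x ^ k) * ENNReal.ofReal (y ^ k)) := by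
  rw [hyp0F1, ENNReal.ofReal_tsum_of_nonneg (hyp0F1_term_nonneg hα (by positivity))
    (summable_hyp0F1 hα _)]
  refine tsum_congr fun k => ?_
  rw [← ENNReal.ofReal_mul (by positivity), ← ENNReal.ofReal_mul (hyp0F1_term_nonneg hα hρ k)]
  congr 1
  ring

lemma ae_pos_prod_gammaMeasure_one (hα : 0 < α) :
    ∀ᵐ p ∂((gammaMeasure α 1).prod (gammaMeasure α 1)), 0 < p.1 ∧ 0 < p.2 := by
  have := isProbabilityMeasure_gammaMeasure hα one_pos
  exact (Measure.quasiMeasurePreserving_fst.ae (ae_pos_gammaMeasure α 1)).and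
    (Measure.quasiMeasurePreserving_snd.ae (ae_pos_gammaMeasure α 1))

lemma lintegral_hyp0F1_mul_prod_gammaMeasure (hα : 0 < α) (hρ : 0 ≤ ρ) {f g : ℝ → ENNReal}
    (hf : Measurable f) (hg : Measurable g) :
    ∫⁻ p, ENNReal.ofReal (hyp0F1 α (ρ * p.1 * p.2)) * (f p.1 * g p.2)
        ∂((gammaMeasure α 1).prod (gammaMeasure α 1)) =
      ∑' k : ℕ, ENNReal.ofReal (Ring.choose (α + k - 1) k * ρ ^ k) *
        ((∫⁻ x, f x ∂(gammaMeasure (α + k) 1)) * ∫⁻ y, g y ∂(gammaMeasure (α + k) 1)) := by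
  have := isProbabilityMeasure_gammaMeasure hα one_pos
  have hexpand : ∀ᵐ p ∂((gammaMeasure α 1).prod (gammaMeasure α 1)),
      ENNReal.ofReal (hyp0F1 α (ρ * p.1 * p.2)) * (f p.1 * g p.2) =
        ∑' k : ℕ, ENNReal.ofReal (ρ ^ k / ((ascPochhammer ℝ k).eval α * (k.factorial : ℝ))) *
          ((ENNReal.ofReal (p.1 ^ k) * f p.1) * (ENNReal.ofReal (p.2 ^ k) * g p.2)) := by
    filter_upwards [ae_pos_prod_gammaMeasure_one hα] with p hp
    rw [ofReal_hyp0F1_mul_mul hα hρ hp.1.le hp.2.le, ← ENNReal.tsum_mul_right]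
    exact tsum_congr fun k => by ring
  rw [lintegral_congr_ae hexpand, lintegral_tsum fun k => by fun_prop]
  refine tsum_congr fun k => ?_
  have hpos := ascPochhammer_pos k α hα
  rw [lintegral_const_mul' _ _ ENNReal.ofReal_ne_top,
    lintegral_prod_mul (f := fun x => ENNReal.ofReal (x ^ k) * f x)
      (g := fun y => ENNReal.ofReal (y ^ k) * g y) (by fun_prop) (by fun_prop),
    lintegral_pow_mul_gammaMeasure hα one_pos, lintegral_pow_mul_gammaMeasure hα one_pos,
    mul_mul_mul_comm (ENNReal.ofReal _), ← mul_assoc, ← ENNReal.ofReal_mul (by positivity),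
    ← ENNReal.ofReal_mul (by positivity)]
  congr 2
  rw [choose_eq_ascPochhammer_div]
  field_simp
  simp only [one_pow, mul_one]

lemma lintegral_hyp0F1_mul_exp (hα : 0 < α) (hρ : 0 ≤ ρ) (hρ1 : ρ < 1) (hs : 0 ≤ s)
    (ht : 0 ≤ t) :
    ∫⁻ p, ENNReal.ofReal (hyp0F1 α (ρ * p.1 * p.2)) *
      (ENNReal.ofReal (Real.exp (-(s * p.1))) * ENNReal.ofReal (Real.exp (-(t * p.2))))
        ∂((gammaMeasure α 1).prod (gammaMeasure α 1)) =
      ENNReal.ofReal (((1 + s) * (1 + t) - ρ) ^ (-α)) := by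
  have hz : |ρ| < (1 + s) * (1 + t) := by
    rw [abs_of_nonneg hρ]
    nlinarith
  have hsum := hasSum_choose_mul_rpow_mul_pow α hz
  have hnonneg (k : ℕ) : 0 ≤ Ring.choose (α + k - 1) k *
      (((1 + s) * (1 + t)) ^ (-α) * (ρ / ((1 + s) * (1 + t))) ^ k) := by
    have hc := choose_pos hα k
    positivity
  rw [lintegral_hyp0F1_mul_prod_gammaMeasure hα hρ
      (f := fun x => ENNReal.ofReal (Real.exp (-(s * x))))
      (g := fun y => ENNReal.ofReal (Real.exp (-(t * y)))) (by fun_prop) (by fun_prop),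
    ← hsum.tsum_eq, ENNReal.ofReal_tsum_of_nonneg hnonneg hsum.summable]
  refine tsum_congr fun k => ?_
  have hc := choose_pos hα k
  rw [lintegral_exp_gammaMeasure (by positivity) one_pos (by positivity),
    lintegral_exp_gammaMeasure (by positivity) one_pos (by positivity),
    ← ENNReal.ofReal_mul (by positivity), ← ENNReal.ofReal_mul (by positivity),
    ← Real.mul_rpow (by positivity) (by positivity), div_mul_div_comm, one_mul, one_div,
    Real.inv_rpow (by positivity), Real.rpow_add (by positivity), Real.rpow_natCast,
    Real.rpow_neg (by positivity), div_pow]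
  congr 1
  field_simp

/-- The density, with respect to the product of two standard gamma distributions, of Kibble's
distribution of correlation `ρ < 1` rescaled by `(1 - ρ)⁻¹`. -/
noncomputable def kibbleDensity (α ρ : ℝ) (p : ℝ × ℝ) : ℝ :=
  (1 - ρ) ^ α * hyp0F1 α (ρ * p.1 * p.2)

@[fun_prop]
lemma measurable_kibbleDensity (hα : 0 < α) (ρ : ℝ) : Measurable (kibbleDensity α ρ) :=
  ((measurable_hyp0F1 hα).comp (by fun_prop)).const_mul _

lemma ae_kibbleDensity_nonneg (hα : 0 < α) (hρ : 0 ≤ ρ) (hρ1 : ρ < 1) :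
    ∀ᵐ p ∂((gammaMeasure α 1).prod (gammaMeasure α 1)), 0 ≤ kibbleDensity α ρ p := by
  filter_upwards [ae_pos_prod_gammaMeasure_one hα] with p ⟨h₁, h₂⟩
  exact mul_nonneg (Real.rpow_nonneg (by linarith) _) (hyp0F1_nonneg hα (by positivity))

/-- Kibble's bivariate gamma distribution with correlation `ρ < 1`, as an explicit measure. -/
noncomputable def kibbleMeasure (α ρ : ℝ) : Measure (ℝ × ℝ) :=
  (((gammaMeasure α 1).prod (gammaMeasure α 1)).withDensity
    fun p => ENNReal.ofReal (kibbleDensity α ρ p)).map fun p => ((1 - ρ) * p.1, (1 - ρ) * p.2)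

lemma lintegral_exp_kibbleMeasure (hα : 0 < α) (hρ : 0 ≤ ρ) (hρ1 : ρ < 1) (hs : 0 ≤ s)
    (ht : 0 ≤ t) :
    ∫⁻ p, ENNReal.ofReal (Real.exp (-(s * p.1)) * Real.exp (-(t * p.2))) ∂(kibbleMeasure α ρ) =
      ENNReal.ofReal (((1 + s) * (1 + t) - ρ * (s * t)) ^ (-α)) := by
  have hr : 0 < 1 - ρ := by linarith
  have hpos : 0 ≤ (1 + s) * (1 + t) - ρ * (s * t) := by nlinarith [mul_nonneg hs ht]
  have hscale : (1 + s * (1 - ρ)) * (1 + t * (1 - ρ)) - ρ =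
      (1 - ρ) * ((1 + s) * (1 + t) - ρ * (s * t)) := by ring
  rw [kibbleMeasure, lintegral_map (by fun_prop) (by fun_prop),
    lintegral_withDensity_eq_lintegral_mul _ (measurable_kibbleDensity hα ρ).ennreal_ofReal
      (by fun_prop)]
  simp only [Pi.mul_apply, kibbleDensity, ENNReal.ofReal_mul (Real.rpow_nonneg hr.le α),
    ENNReal.ofReal_mul (Real.exp_nonneg _), ← mul_assoc s, ← mul_assoc t]
  simp only [mul_assoc (ENNReal.ofReal ((1 - ρ) ^ α))]
  rw [lintegral_const_mul' _ _ ENNReal.ofReal_ne_top,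
    lintegral_hyp0F1_mul_exp hα hρ hρ1 (by positivity) (by positivity), hscale,
    ← ENNReal.ofReal_mul (by positivity), Real.mul_rpow hr.le hpos, ← mul_assoc,
    ← Real.rpow_add hr, add_neg_cancel, Real.rpow_zero, one_mul]

theorem isKibbleLaw_kibbleMeasure (hα : 0 < α) (hρ : 0 ≤ ρ) (hρ1 : ρ < 1) :
    IsKibbleLaw α ρ (kibbleMeasure α ρ) where
  isProbabilityMeasure :=
    ⟨by simpa using lintegral_exp_kibbleMeasure hα hρ hρ1 le_rfl le_rfl⟩
  nonneg := by
    have : 0 < 1 - ρ := by linarith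
    rw [kibbleMeasure, ae_map_iff (by fun_prop) (by measurability)]
    refine (withDensity_absolutelyContinuous _ _).ae_le ?_
    filter_upwards [ae_pos_prod_gammaMeasure_one hα] with p ⟨h₁, h₂⟩
    exact ⟨by positivity, by positivity⟩
  laplace s t hs ht := by
    have hpos : 0 ≤ (1 + s) * (1 + t) - ρ * (s * t) := by nlinarith [mul_nonneg hs ht]
    exact integral_eq_of_lintegral_ofReal_eq (by fun_prop) (ae_of_all _ fun p => by positivity)
      (by positivity) (lintegral_exp_kibbleMeasure hα hρ hρ1 hs ht)

lemma exists_isKibbleLaw (hα : 0 < α) (hρ : 0 ≤ ρ) (hρ1 : ρ ≤ 1) : ∃ ν, IsKibbleLaw α ρ ν := by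
  rcases hρ1.lt_or_eq with hlt | rfl
  · exact ⟨_, isKibbleLaw_kibbleMeasure hα hρ hlt⟩
  · exact ⟨_, isKibbleLaw_map_diag hα⟩

lemma toReal_ofReal_kibbleDensity_smul_ae_eq (hα : 0 < α) (hρ : 0 ≤ ρ) (hρ1 : ρ < 1)
    (f : ℝ × ℝ → ℝ) :
    (fun p => (ENNReal.ofReal (kibbleDensity α ρ p)).toReal • f p)
      =ᵐ[(gammaMeasure α 1).prod (gammaMeasure α 1)]
        fun p => (1 - ρ) ^ α * (f p * hyp0F1 α (ρ * p.1 * p.2)) := by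
  filter_upwards [ae_kibbleDensity_nonneg hα hρ hρ1] with p hp
  rw [ENNReal.toReal_ofReal hp, kibbleDensity, smul_eq_mul]
  ring

lemma integral_kibbleMeasure (hα : 0 < α) (hρ : 0 ≤ ρ) (hρ1 : ρ < 1) {f : ℝ × ℝ → ℝ}
    (hf : AEStronglyMeasurable f (kibbleMeasure α ρ)) :
    ∫ p, f p ∂(kibbleMeasure α ρ) = (1 - ρ) ^ α * ∫ p in Ioi (0 : ℝ) ×ˢ Ioi (0 : ℝ),
      f ((1 - ρ) * p.1, (1 - ρ) * p.2) * hyp0F1 α (ρ * p.1 * p.2) * gPdf α p.1 * gPdf α p.2 := by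
  rw [kibbleMeasure, integral_map (by fun_prop) hf, integral_withDensity_eq_integral_toReal_smul
    (measurable_kibbleDensity hα ρ).ennreal_ofReal (ae_of_all _ fun p => ENNReal.ofReal_lt_top),
    integral_congr_ae (toReal_ofReal_kibbleDensity_smul_ae_eq hα hρ hρ1 _), integral_const_mul,
    integral_prod_gammaMeasure_one hα]

lemma integrable_kibbleMeasure_iff (hα : 0 < α) (hρ : 0 ≤ ρ) (hρ1 : ρ < 1) {f : ℝ × ℝ → ℝ}
    (hf : AEStronglyMeasurable f (kibbleMeasure α ρ)) :
    Integrable f (kibbleMeasure α ρ) ↔ IntegrableOn (fun p : ℝ × ℝ =>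
      f ((1 - ρ) * p.1, (1 - ρ) * p.2) * hyp0F1 α (ρ * p.1 * p.2) * gPdf α p.1 * gPdf α p.2)
        (Ioi 0 ×ˢ Ioi 0) := by
  have hr : (1 - ρ) ^ α ≠ 0 := (Real.rpow_pos_of_pos (by linarith) α).ne'
  rw [kibbleMeasure, integrable_map_measure hf (by fun_prop),
    integrable_withDensity_iff_integrable_smul₀'
      (measurable_kibbleDensity hα ρ).ennreal_ofReal.aemeasurable
      (ae_of_all _ fun p => ENNReal.ofReal_lt_top),
    integrable_congr (toReal_ofReal_kibbleDensity_smul_ae_eq hα hρ hρ1 _),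
    integrable_const_mul_iff hr.isUnit, integrable_prod_gammaMeasure_one_iff hα]
  rfl

end Kibble

section NoncentralGamma

variable {α r : ℝ}

lemma gCdf_nonneg (a x : ℝ) : 0 ≤ gCdf a x := cdf_nonneg _ _

lemma gCdf_le_one (a x : ℝ) : gCdf a x ≤ 1 := cdf_le_one _ _

lemma summable_ncCdf (α x y : ℝ) :
    Summable fun n : ℕ => gCdf (α + n) x * (y ^ n / (n.factorial : ℝ)) := by
  refine Summable.of_norm_bounded (Real.summable_pow_div_factorial |y|) fun n => ?_
  rw [norm_mul, Real.norm_of_nonneg (gCdf_nonneg _ _), norm_div, norm_pow, Real.norm_eq_abs,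
    Real.norm_of_nonneg (by positivity : (0 : ℝ) ≤ (n.factorial : ℝ))]
  exact mul_le_of_le_one_left (by positivity) (gCdf_le_one _ _)

lemma ncCdf_nonneg (α x : ℝ) {y : ℝ} (hy : 0 ≤ y) : 0 ≤ ncCdf α x y :=
  mul_nonneg (Real.exp_nonneg _)
    (tsum_nonneg fun n => mul_nonneg (gCdf_nonneg _ _) (by positivity))

lemma ncCdf_le_one (α x : ℝ) {y : ℝ} (hy : 0 ≤ y) : ncCdf α x y ≤ 1 := by
  have hexp : ∑' n : ℕ, gCdf (α + n) x * (y ^ n / (n.factorial : ℝ)) ≤ Real.exp y := by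
    rw [Real.exp_eq_exp_ℝ, NormedSpace.exp_eq_tsum_div]
    exact (summable_ncCdf α x y).tsum_le_tsum
      (fun n => mul_le_of_le_one_left (by positivity) (gCdf_le_one _ _))
      (Real.summable_pow_div_factorial y)
  calc ncCdf α x y ≤ Real.exp (-y) * Real.exp y := by
        unfold ncCdf
        gcongr
    _ = 1 := by rw [← Real.exp_add, neg_add_cancel, Real.exp_zero]

@[fun_prop]
lemma measurable_ncCdf (α x : ℝ) : Measurable (ncCdf α x) := by
  refine (Real.measurable_exp.comp measurable_neg).mul ?_
  refine measurable_of_tendsto_metrizable (f := fun n y => ∑ k ∈ Finset.range n,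
    gCdf (α + k) x * (y ^ k / (k.factorial : ℝ))) (fun n => by fun_prop) ?_
  exact tendsto_pi_nhds.mpr fun y => (summable_ncCdf α x y).hasSum.tendsto_sum_nat

lemma ae_bind_of_ae_ae {X Y : Type*} [MeasurableSpace X] [MeasurableSpace Y] {μ : Measure X}
    {κ : X → Measure Y} (hκ : AEMeasurable κ μ) {p : Y → Prop} (hp : MeasurableSet {y | p y})
    (h : ∀ᵐ x ∂μ, ∀ᵐ y ∂(κ x), p y) : ∀ᵐ y ∂(μ.bind κ), p y := by
  rw [ae_iff]
  change (μ.bind κ) {y | p y}ᶜ = 0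
  rw [Measure.bind_apply hp.compl hκ]
  exact lintegral_eq_zero_of_ae_eq_zero h

/-- The non-central gamma distribution with rate `r` and non-centrality `y`: the mixture of the
gamma distributions with shapes `α + m`, where `m` is Poisson distributed with mean `y`. -/
noncomputable def ncGammaMeasure (α r : ℝ) (y : NNReal) : Measure ℝ :=
  (poissonMeasure y).bind fun m => gammaMeasure (α + m) r

lemma lintegral_ncGammaMeasure (α r : ℝ) (y : NNReal) {f : ℝ → ENNReal} (hf : Measurable f) :
    ∫⁻ x, f x ∂(ncGammaMeasure α r y) =
      ∑' m : ℕ, ENNReal.ofReal (Real.exp (-y) * (y : ℝ) ^ m / (m.factorial : ℝ)) *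
        ∫⁻ x, f x ∂(gammaMeasure (α + m) r) := by
  rw [ncGammaMeasure, Measure.lintegral_bind Measurable.of_discrete.aemeasurable hf.aemeasurable,
    lintegral_countable']
  simp only [poissonMeasure_singleton, mul_comm]

lemma ncGammaMeasure_apply (α r : ℝ) (y : NNReal) {s : Set ℝ} (hs : MeasurableSet s) :
    ncGammaMeasure α r y s =
      ∑' m : ℕ, ENNReal.ofReal (Real.exp (-y) * (y : ℝ) ^ m / (m.factorial : ℝ)) *
        gammaMeasure (α + m) r s := by
  simpa only [lintegral_indicator_one hs] using
    lintegral_ncGammaMeasure α r y (measurable_one.indicator hs)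

@[fun_prop]
lemma measurable_ncGammaMeasure (α r : ℝ) : Measurable (ncGammaMeasure α r) := by
  refine Measure.measurable_of_measurable_coe _ fun s hs => ?_
  simp only [ncGammaMeasure_apply α r _ hs]
  fun_prop

lemma ae_nonneg_ncGammaMeasure (α r : ℝ) (y : NNReal) :
    ∀ᵐ x ∂(ncGammaMeasure α r y), 0 ≤ x :=
  ae_bind_of_ae_ae Measurable.of_discrete.aemeasurable measurableSet_Ici
    (ae_of_all _ fun m => ae_nonneg_gammaMeasure (α + m) r)

lemma lintegral_exp_ncGammaMeasure (hα : 0 < α) (hr : 0 < r) (y : NNReal) {t : ℝ} (ht : 0 ≤ t) :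
    ∫⁻ x, ENNReal.ofReal (Real.exp (-(t * x))) ∂(ncGammaMeasure α r y) =
      ENNReal.ofReal ((r / (r + t)) ^ α * Real.exp (-(t / (r + t) * y))) := by
  have hrt : 0 < r + t := by positivity
  have hq : 0 < r / (r + t) := by positivity
  have hexp : HasSum (fun m : ℕ => (r / (r + t)) ^ α * Real.exp (-y) *
      ((y * (r / (r + t))) ^ m / (m.factorial : ℝ)))
      ((r / (r + t)) ^ α * Real.exp (-(t / (r + t) * y))) := by
    have hadd : -(t / (r + t) * y) = -y + y * (r / (r + t)) := by
      field_simp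
      ring
    rw [hadd, Real.exp_add, ← mul_assoc]
    refine HasSum.mul_left _ ?_
    rw [Real.exp_eq_exp_ℝ]
    exact NormedSpace.expSeries_div_hasSum_exp _
  rw [lintegral_ncGammaMeasure α r y (by fun_prop), ← hexp.tsum_eq,
    ENNReal.ofReal_tsum_of_nonneg (fun m => by positivity) hexp.summable]
  refine tsum_congr fun m => ?_
  rw [lintegral_exp_gammaMeasure (by positivity) hr hrt, ← ENNReal.ofReal_mul (by positivity),
    Real.rpow_add hq, Real.rpow_natCast, mul_pow]
  congr 1
  ring

lemma isProbabilityMeasure_ncGammaMeasure (hα : 0 < α) (hr : 0 < r) (y : NNReal) :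
    IsProbabilityMeasure (ncGammaMeasure α r y) :=
  ⟨by simpa [hr.ne'] using lintegral_exp_ncGammaMeasure hα hr y le_rfl⟩

lemma ncGammaMeasure_Iic (hα : 0 < α) (hr : 0 < r) (y : NNReal) (x : ℝ) :
    ncGammaMeasure α r y (Iic x) = ENNReal.ofReal (ncCdf α (r * x) y) := by
  rw [ncGammaMeasure_apply α r y measurableSet_Iic, ncCdf, ← tsum_mul_left,
    ENNReal.ofReal_tsum_of_nonneg (fun m => mul_nonneg (Real.exp_nonneg _)
      (mul_nonneg (gCdf_nonneg _ _) (by positivity))) ((summable_ncCdf α _ _).mul_left _)]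
  refine tsum_congr fun m => ?_
  rw [gammaMeasure_Iic (by positivity) hr, ← ENNReal.ofReal_mul (by positivity)]
  congr 1
  ring

end NoncentralGamma

section ComponentLaw

variable {α a : ℝ}

lemma one_sub_sq_pos (ha : a ∈ Ioo (-1 : ℝ) 1) : 0 < 1 - a ^ 2 := by
  nlinarith [ha.1, ha.2]

lemma noncentrality_nonneg (ha : a ∈ Ioo (-1 : ℝ) 1) {y : ℝ} (hy : 0 ≤ y) :
    0 ≤ (1 - a ^ 2)⁻¹ * a ^ 2 * y := by
  have := one_sub_sq_pos ha
  positivity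

/-- The conditional law of one component of the multivariate gamma distribution, given that the
mixing variable of its block takes the value `y ≥ 0`. -/
noncomputable def componentLaw (α a y : ℝ) : Measure ℝ :=
  ncGammaMeasure α (1 - a ^ 2)⁻¹ ((1 - a ^ 2)⁻¹ * a ^ 2 * y).toNNReal

lemma isProbabilityMeasure_componentLaw (hα : 0 < α) (ha : a ∈ Ioo (-1 : ℝ) 1) (y : ℝ) :
    IsProbabilityMeasure (componentLaw α a y) :=
  isProbabilityMeasure_ncGammaMeasure hα (inv_pos.mpr (one_sub_sq_pos ha)) _

lemma ae_nonneg_componentLaw (α a y : ℝ) : ∀ᵐ x ∂(componentLaw α a y), 0 ≤ x :=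
  ae_nonneg_ncGammaMeasure _ _ _

lemma componentLaw_Iic (hα : 0 < α) (ha : a ∈ Ioo (-1 : ℝ) 1) {y : ℝ} (hy : 0 ≤ y) (x : ℝ) :
    componentLaw α a y (Iic x) =
      ENNReal.ofReal (ncCdf α ((1 - a ^ 2)⁻¹ * x) ((1 - a ^ 2)⁻¹ * a ^ 2 * y)) := by
  rw [componentLaw, ncGammaMeasure_Iic hα (inv_pos.mpr (one_sub_sq_pos ha)),
    Real.coe_toNNReal _ (noncentrality_nonneg ha hy)]

lemma one_add_one_sub_sq_mul_pos (ha : a ∈ Ioo (-1 : ℝ) 1) {t : ℝ} (ht : 0 ≤ t) :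
    0 < 1 + (1 - a ^ 2) * t := by
  have := one_sub_sq_pos ha
  positivity

lemma lintegral_exp_componentLaw (hα : 0 < α) (ha : a ∈ Ioo (-1 : ℝ) 1) {y t : ℝ} (hy : 0 ≤ y)
    (ht : 0 ≤ t) :
    ∫⁻ x, ENNReal.ofReal (Real.exp (-(t * x))) ∂(componentLaw α a y) =
      ENNReal.ofReal ((1 + (1 - a ^ 2) * t) ^ (-α) *
        Real.exp (-(a ^ 2 * t / (1 + (1 - a ^ 2) * t) * y))) := by
  have hd := one_sub_sq_pos ha
  have hdt := one_add_one_sub_sq_mul_pos ha ht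
  have hsum : (1 - a ^ 2)⁻¹ + t = (1 + (1 - a ^ 2) * t) / (1 - a ^ 2) := by field_simp
  have hratio : (1 - a ^ 2)⁻¹ / ((1 - a ^ 2)⁻¹ + t) = (1 + (1 - a ^ 2) * t)⁻¹ := by
    rw [hsum]
    field_simp
  have harg : t / ((1 - a ^ 2)⁻¹ + t) * ((1 - a ^ 2)⁻¹ * a ^ 2 * y) =
      a ^ 2 * t / (1 + (1 - a ^ 2) * t) * y := by
    rw [hsum]
    field_simp
  rw [componentLaw, lintegral_exp_ncGammaMeasure hα (inv_pos.mpr hd) _ ht,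
    Real.coe_toNNReal _ (noncentrality_nonneg ha hy), hratio, harg, Real.inv_rpow hdt.le,
    Real.rpow_neg hdt.le]

end ComponentLaw

section ProductLaw

variable {ι : Type*} [Fintype ι] {α : ℝ} {a : ι → ℝ}

lemma lintegral_pi_prod {κ : ι → Measure ℝ} [∀ j, IsProbabilityMeasure (κ j)]
    {f : ι → ℝ → ENNReal} (hf : ∀ j, Measurable (f j)) :
    ∫⁻ x, ∏ j, f j (x j) ∂(Measure.pi κ) = ∏ j, ∫⁻ x, f j x ∂(κ j) := by
  rw [lintegral_prod_eq_prod_lintegral_of_indepFun Finset.univ (fun j (x : ι → ℝ) => f j (x j))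
    (iIndepFun_pi fun j => (hf j).aemeasurable) (fun j => (hf j).comp (measurable_pi_apply j))]
  exact Finset.prod_congr rfl fun j _ => (measurePreserving_eval κ j).lintegral_comp (hf j)

lemma measurable_measure_pi {X : Type*} [MeasurableSpace X] {κ : ι → X → Measure ℝ}
    [∀ j x, IsProbabilityMeasure (κ j x)] (hκ : ∀ j, Measurable (κ j)) :
    Measurable fun x => Measure.pi fun j => κ j x := by
  refine Measurable.measure_of_isPiSystem_of_isProbabilityMeasure generateFrom_pi.symm
    isPiSystem_pi ?_
  rintro _ ⟨s, hs, rfl⟩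
  simp only [Measure.pi_pi]
  exact Finset.measurable_prod _ fun j _ =>
    (Measure.measurable_coe (show MeasurableSet (s j) from hs j trivial)).comp (hκ j)

/-- The joint law of independent components `j`, the mixing variable of component `j` being fixed
at `y j`. -/
noncomputable def productLaw (α : ℝ) (a y : ι → ℝ) : Measure (ι → ℝ) :=
  Measure.pi fun j => componentLaw α (a j) (y j)

lemma measurable_productLaw (hα : 0 < α) (ha : ∀ j, a j ∈ Ioo (-1 : ℝ) 1) :
    Measurable (productLaw α a) := by
  have (j : ι) (y : ι → ℝ) := isProbabilityMeasure_componentLaw hα (ha j) (y j)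
  exact measurable_measure_pi (κ := fun j (y : ι → ℝ) => componentLaw α (a j) (y j)) fun j =>
    (measurable_ncGammaMeasure _ _).comp (by fun_prop)

lemma ae_nonneg_productLaw (hα : 0 < α) (ha : ∀ j, a j ∈ Ioo (-1 : ℝ) 1) (y : ι → ℝ) :
    ∀ᵐ x ∂(productLaw α a y), ∀ j, 0 ≤ x j := by
  have (j : ι) := isProbabilityMeasure_componentLaw hα (ha j) (y j)
  exact ae_all_iff.mpr fun j => (measurePreserving_eval
    (fun j => componentLaw α (a j) (y j)) j).quasiMeasurePreserving.ae
      (ae_nonneg_componentLaw α (a j) (y j))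

lemma productLaw_Iic (hα : 0 < α) (ha : ∀ j, a j ∈ Ioo (-1 : ℝ) 1) {y : ι → ℝ}
    (hy : ∀ j, 0 ≤ y j) (x : ι → ℝ) :
    productLaw α a y (Iic x) = ENNReal.ofReal
      (∏ j, ncCdf α ((1 - a j ^ 2)⁻¹ * x j) ((1 - a j ^ 2)⁻¹ * a j ^ 2 * y j)) := by
  have (j : ι) := isProbabilityMeasure_componentLaw hα (ha j) (y j)
  rw [productLaw, ← pi_univ_Iic, Measure.pi_pi,
    ENNReal.ofReal_prod_of_nonneg fun j _ => ncCdf_nonneg _ _ (noncentrality_nonneg (ha j) (hy j))]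
  exact Finset.prod_congr rfl fun j _ => componentLaw_Iic hα (ha j) (hy j) (x j)

lemma lintegral_exp_productLaw (hα : 0 < α) (ha : ∀ j, a j ∈ Ioo (-1 : ℝ) 1) {y t : ι → ℝ}
    (hy : ∀ j, 0 ≤ y j) (ht : ∀ j, 0 ≤ t j) :
    ∫⁻ x, ENNReal.ofReal (Real.exp (-∑ j, t j * x j)) ∂(productLaw α a y) =
      ENNReal.ofReal ((∏ j, (1 + (1 - a j ^ 2) * t j)) ^ (-α) *
        Real.exp (-∑ j, a j ^ 2 * t j / (1 + (1 - a j ^ 2) * t j) * y j)) := by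
  have (j : ι) := isProbabilityMeasure_componentLaw hα (ha j) (y j)
  have hpos (j : ι) := one_add_one_sub_sq_mul_pos (ha j) (ht j)
  simp_rw [← Finset.sum_neg_distrib, Real.exp_sum,
    ← Real.finsetProd_rpow _ _ fun j _ => (hpos j).le, ← Finset.prod_mul_distrib,
    ENNReal.ofReal_prod_of_nonneg fun _ _ => Real.exp_nonneg _]
  rw [productLaw, lintegral_pi_prod (f := fun j x => ENNReal.ofReal (Real.exp (-(t j * x))))
      fun j => by fun_prop,
    ENNReal.ofReal_prod_of_nonneg fun j _ =>
      mul_nonneg (Real.rpow_nonneg (hpos j).le _) (Real.exp_nonneg _)]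
  exact Finset.prod_congr rfl fun j _ => lintegral_exp_componentLaw hα (ha j) (hy j) (ht j)

end ProductLaw

section Determinant

variable {ι : Type*} [Fintype ι] {n₁ n₂ : ℕ}

/-- The Laplace variable of the mixing variable of a block at which the mixture over that variable
of the conditional Laplace transforms, taken at `t`, is to be evaluated. -/
noncomputable def mixingArg (a t : ι → ℝ) : ℝ :=
  ∑ i, a i ^ 2 * t i / (1 + (1 - a i ^ 2) * t i)

lemma mixingArg_nonneg {a t : ι → ℝ} (ha : ∀ j, a j ∈ Ioo (-1 : ℝ) 1) (ht : ∀ j, 0 ≤ t j) :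
    0 ≤ mixingArg a t :=
  Finset.sum_nonneg fun i _ =>
    div_nonneg (mul_nonneg (sq_nonneg _) (ht i)) (one_add_one_sub_sq_mul_pos (ha i) (ht i)).le

/-- The matrix with columns `(a₁, 0)` and `(0, a₂)`, through which the two-block correlation matrix
is a rank-two perturbation of a diagonal matrix. -/
def blockColumns (a₁ : Fin n₁ → ℝ) (a₂ : Fin n₂ → ℝ) : Matrix (Fin n₁ ⊕ Fin n₂) (Fin 2) ℝ :=
  Matrix.of (Sum.elim (fun i => ![a₁ i, 0]) fun i => ![0, a₂ i])

lemma twoBlockCorr_eq_diagonal_add (a₁ : Fin n₁ → ℝ) (a₂ : Fin n₂ → ℝ) (ϑ : ℝ) :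
    twoBlockCorr a₁ a₂ ϑ = Matrix.diagonal (fun j => 1 - Sum.elim a₁ a₂ j ^ 2) +
      blockColumns a₁ a₂ * (!![1, ϑ; ϑ, 1] * (blockColumns a₁ a₂).transpose) := by
  ext (i | i) (j | j) <;>
    simp [twoBlockCorr, blockColumns, Matrix.mul_apply, Matrix.vecMul, dotProduct,
      Matrix.vecMulVec_apply, Matrix.diagonal_apply, mul_left_comm]

lemma inv_diagonal_of_ne_zero [DecidableEq ι] {d : ι → ℝ}
    (hd : ∀ j, d j ≠ 0) : (Matrix.diagonal d)⁻¹ = Matrix.diagonal fun j => (d j)⁻¹ := by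
  refine Matrix.inv_eq_right_inv ?_
  simp [Matrix.diagonal_mul_diagonal, hd]

lemma transpose_blockColumns_mul_diagonal_mul (a₁ : Fin n₁ → ℝ) (a₂ : Fin n₂ → ℝ)
    (w : Fin n₁ ⊕ Fin n₂ → ℝ) :
    (blockColumns a₁ a₂).transpose * (Matrix.diagonal w * blockColumns a₁ a₂) =
      Matrix.diagonal ![∑ i, a₁ i ^ 2 * w (Sum.inl i), ∑ i, a₂ i ^ 2 * w (Sum.inr i)] := by
  ext i j
  fin_cases i <;> fin_cases j <;>
    simp [blockColumns, Matrix.mul_apply, Matrix.diagonal_apply, sq, mul_comm, mul_assoc]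

lemma det_one_add_twoBlockCorr {a₁ : Fin n₁ → ℝ} {a₂ : Fin n₂ → ℝ} (ϑ : ℝ)
    {t : Fin n₁ ⊕ Fin n₂ → ℝ} (h : ∀ j, 1 + (1 - Sum.elim a₁ a₂ j ^ 2) * t j ≠ 0) :
    (1 + twoBlockCorr a₁ a₂ ϑ * Matrix.diagonal t).det =
      (∏ j, (1 + (1 - Sum.elim a₁ a₂ j ^ 2) * t j)) *
        ((1 + mixingArg a₁ (t ∘ Sum.inl)) * (1 + mixingArg a₂ (t ∘ Sum.inr)) -
          ϑ ^ 2 * (mixingArg a₁ (t ∘ Sum.inl) * mixingArg a₂ (t ∘ Sum.inr))) := by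
  have hsplit : 1 + twoBlockCorr a₁ a₂ ϑ * Matrix.diagonal t =
      Matrix.diagonal (fun j => 1 + (1 - Sum.elim a₁ a₂ j ^ 2) * t j) + blockColumns a₁ a₂ *
        (!![1, ϑ; ϑ, 1] * (blockColumns a₁ a₂).transpose * Matrix.diagonal t) := by
    rw [twoBlockCorr_eq_diagonal_add, add_mul, Matrix.diagonal_mul_diagonal, ← add_assoc,
      ← Matrix.diagonal_one, Matrix.diagonal_add, Matrix.mul_assoc, Matrix.mul_assoc]
  have hsmall : !![1, ϑ; ϑ, 1] * (blockColumns a₁ a₂).transpose * Matrix.diagonal t *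
      (Matrix.diagonal fun j => 1 + (1 - Sum.elim a₁ a₂ j ^ 2) * t j)⁻¹ * blockColumns a₁ a₂ =
      !![1, ϑ; ϑ, 1] *
        Matrix.diagonal ![mixingArg a₁ (t ∘ Sum.inl), mixingArg a₂ (t ∘ Sum.inr)] := by
    rw [inv_diagonal_of_ne_zero h, Matrix.mul_assoc _ (Matrix.diagonal t),
      Matrix.diagonal_mul_diagonal, Matrix.mul_assoc, Matrix.mul_assoc,
      transpose_blockColumns_mul_diagonal_mul]
    simp only [mixingArg, Function.comp_apply, mul_assoc, div_eq_mul_inv, Sum.elim_inl,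
      Sum.elim_inr]
  have hunit : IsUnit (Matrix.diagonal fun j => 1 + (1 - Sum.elim a₁ a₂ j ^ 2) * t j).det := by
    rw [Matrix.det_diagonal]
    exact (Finset.prod_ne_zero_iff.mpr fun j _ => h j).isUnit
  rw [hsplit, Matrix.det_add_mul _ _ hunit, hsmall, Matrix.det_diagonal, Matrix.det_fin_two]
  congr 1
  simp only [Nat.succ_eq_add_one, Nat.reduceAdd, Matrix.cons_mul, Matrix.empty_mul,
    Equiv.symm_apply_apply, Fin.isValue, Matrix.add_apply, Matrix.one_apply_eq, Matrix.of_apply,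
    Matrix.cons_val', Matrix.vecMul_diagonal, Matrix.cons_val_zero, one_mul,
    Matrix.cons_val_fin_one, Matrix.cons_val_one, ne_eq, zero_ne_one, not_false_eq_true,
    Matrix.one_apply_ne, zero_add, one_ne_zero, sub_right_inj]
  ring

end Determinant

section TwoBlock

variable {n₁ n₂ : ℕ} {a₁ : Fin n₁ → ℝ} {a₂ : Fin n₂ → ℝ} {α ϑ : ℝ} {ν : Measure (ℝ × ℝ)}

/-- The law of a vector whose components are independent given the pair `p` of mixing variables of
the two blocks, where `p` is distributed according to `ν`. -/
noncomputable def twoBlockLaw (α : ℝ) (a₁ : Fin n₁ → ℝ) (a₂ : Fin n₂ → ℝ)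
    (ν : Measure (ℝ × ℝ)) : Measure (Fin n₁ ⊕ Fin n₂ → ℝ) :=
  ν.bind fun p => productLaw α (Sum.elim a₁ a₂) (Sum.elim (fun _ => p.1) fun _ => p.2)

lemma measurable_twoBlock_productLaw (hα : 0 < α)
    (ha : ∀ j, Sum.elim a₁ a₂ j ∈ Ioo (-1 : ℝ) 1) :
    Measurable fun p : ℝ × ℝ =>
      productLaw α (Sum.elim a₁ a₂) (Sum.elim (fun _ => p.1) fun _ => p.2) := by
  refine (measurable_productLaw hα ha).comp (measurable_pi_iff.mpr ?_)
  rintro (_ | _)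
  exacts [measurable_fst, measurable_snd]

lemma det_one_add_twoBlockCorr_pos (ha : ∀ j, Sum.elim a₁ a₂ j ∈ Ioo (-1 : ℝ) 1) (hϑ : ϑ ^ 2 ≤ 1)
    {t : Fin n₁ ⊕ Fin n₂ → ℝ} (ht : ∀ j, 0 ≤ t j) :
    0 < (1 + twoBlockCorr a₁ a₂ ϑ * Matrix.diagonal t).det := by
  have hpos (j) := one_add_one_sub_sq_mul_pos (ha j) (ht j)
  have h₁ := mixingArg_nonneg (a := a₁) (t := t ∘ Sum.inl) (fun j => ha (Sum.inl j)) fun j => ht _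
  have h₂ := mixingArg_nonneg (a := a₂) (t := t ∘ Sum.inr) (fun j => ha (Sum.inr j)) fun j => ht _
  rw [det_one_add_twoBlockCorr ϑ fun j => (hpos j).ne']
  exact mul_pos (Finset.prod_pos fun j _ => hpos j) (by nlinarith [mul_nonneg h₁ h₂])

lemma lintegral_exp_twoBlockLaw (hα : 0 < α) (ha : ∀ j, Sum.elim a₁ a₂ j ∈ Ioo (-1 : ℝ) 1)
    (hϑ : ϑ ^ 2 ≤ 1) (hν : IsKibbleLaw α (ϑ ^ 2) ν) {t : Fin n₁ ⊕ Fin n₂ → ℝ}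
    (ht : ∀ j, 0 ≤ t j) :
    ∫⁻ x, ENNReal.ofReal (Real.exp (-∑ j, t j * x j)) ∂(twoBlockLaw α a₁ a₂ ν) =
      ENNReal.ofReal ((1 + twoBlockCorr a₁ a₂ ϑ * Matrix.diagonal t).det ^ (-α)) := by
  have hpos (j) := one_add_one_sub_sq_mul_pos (ha j) (ht j)
  have hprod := Finset.prod_pos fun j (_ : j ∈ Finset.univ) => hpos j
  have h₁ := mixingArg_nonneg (a := a₁) (t := t ∘ Sum.inl) (fun j => ha (Sum.inl j)) fun j => ht _
  have h₂ := mixingArg_nonneg (a := a₂) (t := t ∘ Sum.inr) (fun j => ha (Sum.inr j)) fun j => ht _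
  rw [det_one_add_twoBlockCorr ϑ fun j => (hpos j).ne',
    Real.mul_rpow hprod.le (by nlinarith [mul_nonneg h₁ h₂]), ENNReal.ofReal_mul (by positivity),
    ← hν.lintegral_exp h₁ h₂, ← lintegral_const_mul' _ _ ENNReal.ofReal_ne_top, twoBlockLaw,
    Measure.lintegral_bind (measurable_twoBlock_productLaw hα ha).aemeasurable
      (Measurable.aemeasurable (by fun_prop))]
  refine lintegral_congr_ae ?_
  filter_upwards [hν.nonneg] with p hp
  have hp' : ∀ j, 0 ≤ (Sum.elim (fun _ => p.1) fun _ => p.2 : Fin n₁ ⊕ Fin n₂ → ℝ) j :=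
    Sum.forall.mpr ⟨fun _ => hp.1, fun _ => hp.2⟩
  rw [lintegral_exp_productLaw hα ha hp' ht, ← ENNReal.ofReal_mul (by positivity), ← Real.exp_add,
    ← neg_add, Fintype.sum_sum_type]
  simp only [Sum.elim_inl, Sum.elim_inr, ← Finset.sum_mul, mixingArg, Function.comp_apply]

theorem isGammaLaw_twoBlockLaw (hα : 0 < α) (ha₁ : ∀ j, a₁ j ∈ Ioo (-1 : ℝ) 1)
    (ha₂ : ∀ j, a₂ j ∈ Ioo (-1 : ℝ) 1) (hϑ : ϑ ^ 2 ≤ 1) (hν : IsKibbleLaw α (ϑ ^ 2) ν) :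
    IsGammaLaw α (twoBlockCorr a₁ a₂ ϑ) (twoBlockLaw α a₁ a₂ ν) := by
  have ha := Sum.forall (p := fun j => Sum.elim a₁ a₂ j ∈ Ioo (-1 : ℝ) 1).mpr ⟨ha₁, ha₂⟩
  refine ⟨⟨?_⟩, ?_, fun t ht => ?_⟩
  · simpa using lintegral_exp_twoBlockLaw hα ha hϑ hν (t := 0) fun _ => le_rfl
  · exact ae_bind_of_ae_ae (measurable_twoBlock_productLaw hα ha).aemeasurable
      (by measurability) (ae_of_all _ fun p => ae_nonneg_productLaw hα ha _)
  · exact integral_eq_of_lintegral_ofReal_eq (Measurable.aestronglyMeasurable (by fun_prop))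
      (ae_of_all _ fun x => Real.exp_nonneg _)
      (Real.rpow_nonneg (det_one_add_twoBlockCorr_pos ha hϑ ht).le _)
      (lintegral_exp_twoBlockLaw hα ha hϑ hν ht)

lemma IsGammaLaw.unique {ι : Type*} [Fintype ι] [DecidableEq ι] {R : Matrix ι ι ℝ}
    {μ μ' : Measure (ι → ℝ)} (hμ : IsGammaLaw α R μ) (hμ' : IsGammaLaw α R μ') : μ = μ' := by
  have := hμ.isProbabilityMeasure
  have := hμ'.isProbabilityMeasure
  exact ext_of_laplace hμ.nonneg hμ'.nonneg fun t ht => by rw [hμ.laplace t ht, hμ'.laplace t ht]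

theorem existsUnique_isGammaLaw_twoBlockCorr (hα : 0 < α) (ha₁ : ∀ j, a₁ j ∈ Ioo (-1 : ℝ) 1)
    (ha₂ : ∀ j, a₂ j ∈ Ioo (-1 : ℝ) 1) (hϑ : ϑ ^ 2 ≤ 1) :
    ∃! μ, IsGammaLaw α (twoBlockCorr a₁ a₂ ϑ) μ := by
  obtain ⟨ν, hν⟩ := exists_isKibbleLaw hα (sq_nonneg ϑ) hϑ
  have hμ := isGammaLaw_twoBlockLaw hα ha₁ ha₂ hϑ hν
  exact ⟨_, hμ, fun μ' hμ' => hμ'.unique hμ⟩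

@[fun_prop]
lemma measurable_blockProd {m : ℕ} (α : ℝ) (a x : Fin m → ℝ) : Measurable (blockProd α a x) := by
  unfold blockProd
  fun_prop

lemma blockProd_nonneg {m : ℕ} (α : ℝ) {a : Fin m → ℝ} (ha : ∀ j, a j ∈ Ioo (-1 : ℝ) 1)
    (x : Fin m → ℝ) {y : ℝ} (hy : 0 ≤ y) : 0 ≤ blockProd α a x y :=
  Finset.prod_nonneg fun j _ => ncCdf_nonneg _ _ (noncentrality_nonneg (ha j) hy)

lemma norm_blockProd_le_one {m : ℕ} (α : ℝ) {a : Fin m → ℝ} (ha : ∀ j, a j ∈ Ioo (-1 : ℝ) 1)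
    (x : Fin m → ℝ) {y : ℝ} (hy : 0 ≤ y) : ‖blockProd α a x y‖ ≤ 1 := by
  rw [Real.norm_of_nonneg (blockProd_nonneg α ha x hy)]
  exact Finset.prod_le_one (fun j _ => ncCdf_nonneg _ _ (noncentrality_nonneg (ha j) hy))
    fun j _ => ncCdf_le_one _ _ (noncentrality_nonneg (ha j) hy)

lemma memLp_blockProd {m : ℕ} (hα : 0 < α) {a : Fin m → ℝ} (ha : ∀ j, a j ∈ Ioo (-1 : ℝ) 1)
    (x : Fin m → ℝ) : MemLp (blockProd α a x) 2 (gammaMeasure α 1) := by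
  have := isProbabilityMeasure_gammaMeasure hα one_pos
  exact MemLp.of_bound (by fun_prop) 1
    ((ae_nonneg_gammaMeasure α 1).mono fun y hy => norm_blockProd_le_one α ha x hy)

lemma integrableOn_blockProd_mul_laguerre {m : ℕ} (hα : 0 < α) {a : Fin m → ℝ}
    (ha : ∀ j, a j ∈ Ioo (-1 : ℝ) 1) (x : Fin m → ℝ) (k : ℕ) :
    IntegrableOn (fun y => blockProd α a x y * laguerre (α - 1) k y * gPdf α y) (Ioi 0) :=
  (integrable_gammaMeasure_one_iff hα _).mp
    ((memLp_blockProd hα ha x).integrable_mul (memLp_laguerre hα k))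

lemma jointCdf_twoBlockLaw {ρ : ℝ} (hα : 0 < α) (ha₁ : ∀ j, a₁ j ∈ Ioo (-1 : ℝ) 1)
    (ha₂ : ∀ j, a₂ j ∈ Ioo (-1 : ℝ) 1) (hν : IsKibbleLaw α ρ ν) (x₁ : Fin n₁ → ℝ)
    (x₂ : Fin n₂ → ℝ) :
    jointCdf (twoBlockLaw α a₁ a₂ ν) (Sum.elim x₁ x₂) =
      ∫ p, blockProd α a₁ x₁ p.1 * blockProd α a₂ x₂ p.2 ∂ν := by
  have ha := Sum.forall (p := fun j => Sum.elim a₁ a₂ j ∈ Ioo (-1 : ℝ) 1).mpr ⟨ha₁, ha₂⟩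
  rw [integral_eq_lintegral_of_nonneg_ae _ (by fun_prop)]
  · change (twoBlockLaw α a₁ a₂ ν).real (Iic (Sum.elim x₁ x₂)) = _
    rw [measureReal_def, twoBlockLaw, Measure.bind_apply measurableSet_Iic
      (measurable_twoBlock_productLaw hα ha).aemeasurable]
    congr 1
    refine lintegral_congr_ae (hν.nonneg.mono fun p hp => ?_)
    dsimp only
    rw [productLaw_Iic hα ha (Sum.forall.mpr ⟨fun _ => hp.1, fun _ => hp.2⟩),
      Fintype.prod_sum_type]
    rfl
  · exact hν.nonneg.mono fun p hp =>
      mul_nonneg (blockProd_nonneg α ha₁ x₁ hp.1) (blockProd_nonneg α ha₂ x₂ hp.2)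

theorem IsGammaLaw.hasSum_jointCdf_twoBlockCorr {μ : Measure (Fin n₁ ⊕ Fin n₂ → ℝ)}
    (hμ : IsGammaLaw α (twoBlockCorr a₁ a₂ ϑ) μ) (hα : 0 < α)
    (ha₁ : ∀ j, a₁ j ∈ Ioo (-1 : ℝ) 1) (ha₂ : ∀ j, a₂ j ∈ Ioo (-1 : ℝ) 1) (hϑ : ϑ ^ 2 ≤ 1)
    (x₁ : Fin n₁ → ℝ) (x₂ : Fin n₂ → ℝ) :
    HasSum (fun k : ℕ => (Ring.choose (α + (k : ℝ) - 1) k)⁻¹ * ϑ ^ (2 * k) *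
        (∫ y in Ioi (0 : ℝ), blockProd α a₁ x₁ y * laguerre (α - 1) k y * gPdf α y) *
        ∫ y in Ioi (0 : ℝ), blockProd α a₂ x₂ y * laguerre (α - 1) k y * gPdf α y)
      (jointCdf μ (Sum.elim x₁ x₂)) := by
  obtain ⟨ν, hν⟩ := exists_isKibbleLaw hα (sq_nonneg ϑ) hϑ
  rw [hμ.unique (isGammaLaw_twoBlockLaw hα ha₁ ha₂ hϑ hν), jointCdf_twoBlockLaw hα ha₁ ha₂ hν]
  simpa only [integral_gammaMeasure_one hα, pow_mul] using
    hν.hasSum_laguerre hα (by rwa [abs_of_nonneg (sq_nonneg ϑ)])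
      (memLp_blockProd hα ha₁ x₁) (memLp_blockProd hα ha₂ x₂)

lemma integrableOn_blockProd_mul_hyp0F1 {ρ : ℝ} (hα : 0 < α) (ha₁ : ∀ j, a₁ j ∈ Ioo (-1 : ℝ) 1)
    (ha₂ : ∀ j, a₂ j ∈ Ioo (-1 : ℝ) 1) (hρ : 0 ≤ ρ) (hρ1 : ρ < 1) (x₁ : Fin n₁ → ℝ)
    (x₂ : Fin n₂ → ℝ) :
    IntegrableOn (fun p : ℝ × ℝ => blockProd α a₁ x₁ ((1 - ρ) * p.1) *
      blockProd α a₂ x₂ ((1 - ρ) * p.2) * hyp0F1 α (ρ * p.1 * p.2) * gPdf α p.1 * gPdf α p.2)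
        (Ioi 0 ×ˢ Ioi 0) := by
  have hint : Integrable (fun p : ℝ × ℝ => blockProd α a₁ x₁ p.1 * blockProd α a₂ x₂ p.2)
      (kibbleMeasure α ρ) :=
    (isKibbleLaw_kibbleMeasure hα hρ hρ1).integrable_of_norm_le (c := 1) (by fun_prop)
      fun p h₁ h₂ => by
        rw [norm_mul]
        exact mul_le_one₀ (norm_blockProd_le_one α ha₁ x₁ h₁) (norm_nonneg _)
          (norm_blockProd_le_one α ha₂ x₂ h₂)
  exact (integrable_kibbleMeasure_iff hα hρ hρ1 hint.aestronglyMeasurable).mp hint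

theorem IsGammaLaw.jointCdf_twoBlockCorr_eq_integral {μ : Measure (Fin n₁ ⊕ Fin n₂ → ℝ)}
    (hμ : IsGammaLaw α (twoBlockCorr a₁ a₂ ϑ) μ) (hα : 0 < α)
    (ha₁ : ∀ j, a₁ j ∈ Ioo (-1 : ℝ) 1) (ha₂ : ∀ j, a₂ j ∈ Ioo (-1 : ℝ) 1) (hϑ : ϑ ^ 2 < 1)
    (x₁ : Fin n₁ → ℝ) (x₂ : Fin n₂ → ℝ) :
    jointCdf μ (Sum.elim x₁ x₂) =
      (1 - ϑ ^ 2) ^ α * ∫ p in Ioi (0 : ℝ) ×ˢ Ioi (0 : ℝ),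
        blockProd α a₁ x₁ ((1 - ϑ ^ 2) * p.1) * blockProd α a₂ x₂ ((1 - ϑ ^ 2) * p.2) *
          hyp0F1 α (ϑ ^ 2 * p.1 * p.2) * gPdf α p.1 * gPdf α p.2 := by
  have hν := isKibbleLaw_kibbleMeasure hα (sq_nonneg ϑ) hϑ
  rw [hμ.unique (isGammaLaw_twoBlockLaw hα ha₁ ha₂ hϑ.le hν), jointCdf_twoBlockLaw hα ha₁ ha₂ hν,
    integral_kibbleMeasure hα (sq_nonneg ϑ) hϑ (by fun_prop)]

end TwoBlock

end MultivariateGamma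

theorem theorem3 (n₁ n₂ : ℕ) (hn₁ : 1 < n₁) (hn₂ : 1 < n₂)
    (a₁ : Fin n₁ → ℝ) (a₂ : Fin n₂ → ℝ)
    (ha₁ : ∀ j, a₁ j ∈ Ioo (-1 : ℝ) 1) (ha₂ : ∀ j, a₂ j ∈ Ioo (-1 : ℝ) 1)
    (α ϑ : ℝ) (hα : 0 < α) (hϑ : |ϑ| ≤ 1) :
    (∃! μ : Measure (Fin n₁ ⊕ Fin n₂ → ℝ),
      MultivariateGamma.IsGammaLaw α (MultivariateGamma.twoBlockCorr a₁ a₂ ϑ) μ) ∧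
    ∀ μ : Measure (Fin n₁ ⊕ Fin n₂ → ℝ),
      MultivariateGamma.IsGammaLaw α (MultivariateGamma.twoBlockCorr a₁ a₂ ϑ) μ →
      ∀ (x₁ : Fin n₁ → ℝ) (x₂ : Fin n₂ → ℝ),
        ((∀ k : ℕ, IntegrableOn (fun y => MultivariateGamma.blockProd α a₁ x₁ y *
            MultivariateGamma.laguerre (α - 1) k y * MultivariateGamma.gPdf α y) (Ioi 0)) ∧
          (∀ k : ℕ, IntegrableOn (fun y => MultivariateGamma.blockProd α a₂ x₂ y *
            MultivariateGamma.laguerre (α - 1) k y * MultivariateGamma.gPdf α y) (Ioi 0)) ∧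
          HasSum (fun k : ℕ => (Ring.choose (α + (k : ℝ) - 1) k)⁻¹ * ϑ ^ (2 * k) *
              (∫ y in Ioi (0 : ℝ), MultivariateGamma.blockProd α a₁ x₁ y *
                MultivariateGamma.laguerre (α - 1) k y * MultivariateGamma.gPdf α y) *
              (∫ y in Ioi (0 : ℝ), MultivariateGamma.blockProd α a₂ x₂ y *
                MultivariateGamma.laguerre (α - 1) k y * MultivariateGamma.gPdf α y))
            (MultivariateGamma.jointCdf μ (Sum.elim x₁ x₂))) ∧
        (|ϑ| < 1 →
          IntegrableOn (fun y : ℝ × ℝ =>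
            MultivariateGamma.blockProd α a₁ x₁ ((1 - ϑ ^ 2) * y.1) *
              MultivariateGamma.blockProd α a₂ x₂ ((1 - ϑ ^ 2) * y.2) *
              MultivariateGamma.hyp0F1 α (ϑ ^ 2 * y.1 * y.2) *
              MultivariateGamma.gPdf α y.1 * MultivariateGamma.gPdf α y.2)
            (Ioi 0 ×ˢ Ioi 0) ∧
          MultivariateGamma.jointCdf μ (Sum.elim x₁ x₂) =
            (1 - ϑ ^ 2) ^ α * ∫ y in Ioi (0 : ℝ) ×ˢ Ioi (0 : ℝ),
              MultivariateGamma.blockProd α a₁ x₁ ((1 - ϑ ^ 2) * y.1) *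
              MultivariateGamma.blockProd α a₂ x₂ ((1 - ϑ ^ 2) * y.2) *
              MultivariateGamma.hyp0F1 α (ϑ ^ 2 * y.1 * y.2) *
              MultivariateGamma.gPdf α y.1 * MultivariateGamma.gPdf α y.2) := by
  have hϑ2 : ϑ ^ 2 ≤ 1 := sq_le_one_iff_abs_le_one ϑ |>.mpr hϑ
  refine ⟨MultivariateGamma.existsUnique_isGammaLaw_twoBlockCorr hα ha₁ ha₂ hϑ2,
    fun μ hμ x₁ x₂ => ⟨⟨?_, ?_, ?_⟩, fun hlt => ?_⟩⟩
  · exact MultivariateGamma.integrableOn_blockProd_mul_laguerre hα ha₁ x₁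
  · exact MultivariateGamma.integrableOn_blockProd_mul_laguerre hα ha₂ x₂
  · exact hμ.hasSum_jointCdf_twoBlockCorr hα ha₁ ha₂ hϑ2 x₁ x₂
  · have hϑ2' : ϑ ^ 2 < 1 := sq_lt_one_iff_abs_lt_one ϑ |>.mpr hlt
    exact ⟨MultivariateGamma.integrableOn_blockProd_mul_hyp0F1 hα ha₁ ha₂ (sq_nonneg ϑ) hϑ2' x₁ x₂,
      hμ.jointCdf_twoBlockCorr_eq_integral hα ha₁ ha₂ hϑ2' x₁ x₂⟩
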